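/- Theorem (Characterisation of cofibrations). Let $\mathcal{E}$ be a countably lextensive category, i.e. a category with finite limits and countable coproducts in which countable coproducts are van Kampen colimits, and let $s\mathcal{E} = [\Delta^{\mathrm{op}}, \mathcal{E}]$ be the category of simplicial objects in $\mathcal{E}$. A map $A \to B$ in $\mathcal{E}$ is a complemented inclusion if there is a map $C \to B$ such that the two maps exhibit $B$ as a coproduct of $A$ and $C$. For $T \in \mathcal{E}$ and $X \in s\mathcal{E}$ let $T \times X$ be the simplicial object with $(T \times X)_n = T \times X_n$, and for $X, Y \in s\mathcal{E}$ let $\mathrm{Hom}(X, Y)$ be the presheaf $T \mapsto s\mathcal{E}(T \times X, Y)$ on $\mathcal{E}$. A map $i \colon A \to B$ in $s\mathcal{E}$ has the enriched left lifting property with respect to $p \colon X \to Y$ (and $p$ has the enriched right lifting property with respect to $i$) if the map $$\mathrm{Hom}(B, X) \to \mathrm{Hom}(A, X) \times_{\mathrm{Hom}(A, Y)} \mathrm{Hom}(B, Y)$$ is a split epimorphism of presheaves on $\mathcal{E}$. For a levelwise countable simplicial set $K$ let $\underline{K} \in s\mathcal{E}$ be given by $\underline{K}_n = \coprod_{K_n}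 1$. A map in $s\mathcal{E}$ is a cofibration if it has the enriched left lifting property with respect to every map that has the enriched right lifting property with respect to all the maps $\underline{\partial\Delta[n]} \to \underline{\Delta[n]}$, $n \geq 0$. Let $i \colon A \to B$ be a map in $s\mathcal{E}$. Then the following are equivalent: (i) the map $i$ is a cofibration; (ii) every component $A_n \to B_n$ is a complemented inclusion in $\mathcal{E}$, and for every degeneracy operator $[m] \to [n]$ (surjective monotone map) the pushout $A_m \sqcup_{A_n} B_n$ exists and the induced map $A_m \sqcup_{A_n} B_n \to B_m$ is a complemented inclusion in $\mathcal{E}$. -/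

import Mathlib

open CategoryTheory CategoryTheory.Limits Opposite Simplicial

universe v u

noncomputable section

namespace EffectiveModel

/-- A category is countably lextensive if it has finite limits and countable coproducts, and
countable coproducts are van Kampen colimits. -/
class CountablyLextensive (E : Type u) [Category.{v} E] : Prop where
  [hasFiniteLimits : HasFiniteLimits E]
  [hasCountableCoproducts : HasCountableCoproducts E]
  isVanKampen : ∀ (J : Type) [Countable J] (F : Discrete J ⥤ E) (c : Cocone F),
    IsColimit c → IsVanKampenColimit c

attribute [instance] CountablyLextensive.hasFiniteLimits
attribute [instance] CountablyLextensive.hasCountableCoproducts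

section

variable {E : Type u} [Category.{v} E]

/-- A map `i : A ⟶ B` is a complemented inclusion if there is a map `j : C ⟶ B` such that
`i` and `j` exhibit `B` as a coproduct of `A` and `C`. -/
def IsComplementedInclusion {A B : E} (i : A ⟶ B) : Prop :=
  ∃ (C : E) (j : C ⟶ B), Nonempty (IsColimit (BinaryCofan.mk i j))

/-- A map of simplicial objects all of whose components are complemented inclusions. -/
def IsLevelwiseComplementedInclusion {A B : SimplicialObject E} (i : A ⟶ B) : Prop :=
  ∀ n : SimplexCategory, IsComplementedInclusion (i.app (op n))

end

section Enrichment

variable {E : Type u} [Category.{v} E] [HasFiniteLimits E]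

/-- The simplicial object `T × X` with `(T × X)_n = T × X_n`. -/
abbrev tensor (T : E) (X : SimplicialObject E) : SimplicialObject E :=
  X ⋙ prod.functor.obj T

/-- The map `T × f : T × X ⟶ T × Y`. -/
abbrev tensorMapRight (T : E) {X Y : SimplicialObject E} (f : X ⟶ Y) : tensor T X ⟶ tensor T Y :=
  Functor.whiskerRight f (prod.functor.obj T)

/-- The map `t × X : S × X ⟶ T × X`. -/
abbrev tensorMapLeft {S T : E} (t : S ⟶ T) (X : SimplicialObject E) : tensor S X ⟶ tensor T X :=
  Functor.whiskerLeft X (prod.functor.map t)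

/-- The hom-presheaf `T ↦ Hom(T × X, Y)` on `E`. -/
def homPsh (X Y : SimplicialObject E) : Eᵒᵖ ⥤ Type v where
  obj T := tensor T.unop X ⟶ Y
  map t := ↾fun u ↦ tensorMapLeft t.unop X ≫ u
  map_id T := by
    ext u
    simp
  map_comp s t := by
    ext u
    simp [← Category.assoc]

lemma tensorMapLeft_comp_tensorMapRight {S T : E} (t : S ⟶ T) {A B : SimplicialObject E}
    (i : A ⟶ B) : tensorMapLeft t A ≫ tensorMapRight T i =
      tensorMapRight S i ≫ tensorMapLeft t B := by
  ext n
  exact (prod.functor.map t).naturality (i.app n) |>.symm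

/-- The presheaf of lifting problems of `i` against `p`, that is, the pullback
`Hom(A, X) ×_{Hom(A, Y)} Hom(B, Y)`. Its value at `T` is the set of commutative squares
from `T × i` to `p`. -/
def probPsh {A B X Y : SimplicialObject E} (i : A ⟶ B) (p : X ⟶ Y) : Eᵒᵖ ⥤ Type v where
  obj T := { w : (tensor T.unop A ⟶ X) × (tensor T.unop B ⟶ Y) //
    w.1 ≫ p = tensorMapRight T.unop i ≫ w.2 }
  map {S T} t := ↾fun w ↦
    ⟨(tensorMapLeft t.unop A ≫ w.1.1, tensorMapLeft t.unop B ≫ w.1.2), by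
      rw [Category.assoc, w.2, ← Category.assoc, tensorMapLeft_comp_tensorMapRight,
        Category.assoc]⟩
  map_id T := by
    ext w <;> simp
  map_comp s t := by
    ext w <;> simp [← Category.assoc]

/-- The pullback hom `Hom(B, X) ⟶ Hom(A, X) ×_{Hom(A, Y)} Hom(B, Y)` of presheaves on `E`. -/
def pullbackHom {A B X Y : SimplicialObject E} (i : A ⟶ B) (p : X ⟶ Y) :
    homPsh B X ⟶ probPsh i p where
  app T := ↾fun d : tensor T.unop B ⟶ X ↦
    ⟨(tensorMapRight T.unop i ≫ d, d ≫ p), Category.assoc _ _ _⟩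
  naturality S T t := by
    ext (d : tensor S.unop B ⟶ X)
    apply Subtype.ext
    refine Prod.ext ?_ (Category.assoc _ _ _)
    exact (Category.assoc _ _ _).symm.trans
      ((congrArg (· ≫ d) (tensorMapLeft_comp_tensorMapRight t.unop i).symm).trans
        (Category.assoc _ _ _))

/-- The enriched lifting property of `i` on the left against `p` on the right: the pullback hom
is a split epimorphism of presheaves. -/
def HasEnrichedLiftingProperty {A B X Y : SimplicialObject E} (i : A ⟶ B) (p : X ⟶ Y) : Prop :=
  IsSplitEpi (pullbackHom i p)

/-- Enriched `I`-fibrations: the maps with the enriched right lifting property against `I`. -/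
def IsEnrichedFibration (I : MorphismProperty (SimplicialObject E))
    {X Y : SimplicialObject E} (p : X ⟶ Y) : Prop :=
  ∀ ⦃A B : SimplicialObject E⦄ (i : A ⟶ B), I i → HasEnrichedLiftingProperty i p

/-- Enriched `I`-cofibrations: the maps with the enriched left lifting property against
all enriched `I`-fibrations. -/
def IsEnrichedCofibration (I : MorphismProperty (SimplicialObject E))
    {A B : SimplicialObject E} (i : A ⟶ B) : Prop :=
  ∀ ⦃X Y : SimplicialObject E⦄ (p : X ⟶ Y), IsEnrichedFibration I p →
    HasEnrichedLiftingProperty i p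

end Enrichment

section Generators

variable (E : Type u) [Category.{v} E] [CountablyLextensive E]

/-- The simplicial object associated with a levelwise countable simplicial set `K`: in degree `n`
it is the coproduct of copies of the terminal object indexed by `K_n`. -/
def discreteObj (K : SSet.{0}) [∀ n, Countable (K.obj n)] : SimplicialObject E where
  obj n := ∐ fun _ : K.obj n ↦ ⊤_ E
  map f := Sigma.map' (K.map f) fun _ ↦ 𝟙 _
  map_id n := by
    ext x
    simp
  map_comp f g := by
    ext x
    simp

/-- The action of `discreteObj` on maps of simplicial sets. -/
def discreteMap {K L : SSet.{0}} [∀ n, Countable (K.obj n)] [∀ n, Countable (L.obj n)]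
    (f : K ⟶ L) : discreteObj E K ⟶ discreteObj E L where
  app n := Sigma.map' (f.app n) fun _ ↦ 𝟙 _
  naturality m n g := by
    dsimp [discreteObj]
    ext x
    simp

/-- The images in simplicial objects of the boundary inclusions `∂Δ[n] ⟶ Δ[n]`, `n ≥ 0`. -/
def boundaryInclusions : MorphismProperty (SimplicialObject E) :=
  MorphismProperty.ofHoms fun n : ℕ ↦ discreteMap E (SSet.boundary.{0} n).ι

end Generators

section Cofibrations

variable {E : Type u} [Category.{v} E] [CountablyLextensive E]

/-- A cofibration of simplicial objects is an enriched cofibration with respect to the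
boundary inclusions. -/
def IsCofibration {A B : SimplicialObject E} (i : A ⟶ B) : Prop :=
  IsEnrichedCofibration (boundaryInclusions E) i

end Cofibrations

section Degeneracies

variable {E : Type u} [Category.{v} E]

/-- For `s : [m] ⟶ [n]`, the pushout `A_m ⊔_{A_n} B_n` exists and the induced map
`A_m ⊔_{A_n} B_n ⟶ B_m` is a complemented inclusion. -/
def IsRelativelyComplementedAt {A B : SimplicialObject E} (i : A ⟶ B)
    {m n : SimplexCategory} (s : m ⟶ n) : Prop :=
  ∃ _ : HasPushout (A.map s.op) (i.app (op n)),
    IsComplementedInclusion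
      (pushout.desc (i.app (op m)) (B.map s.op) (i.naturality s.op) :
        pushout (A.map s.op) (i.app (op n)) ⟶ B.obj (op m))

end Degeneracies

end EffectiveModel

end

noncomputable section

namespace EffectiveModel

/-!
By the Yoneda lemma, the enriched lifting property of `i : A ⟶ B` against `p : X ⟶ Y` says that
`P × i` has the ordinary lifting property against `p` in simplicial presheaves, for every presheaf
`P` on `E`. In the same way, `p` is an enriched fibration if and only if `p` lifts against the maps
`P × ∂Δ[n] ⟶ P × Δ[n]`.

If `i` satisfies the complementedness conditions, then a lift is built one degree at a time. In
degree `n` a boundary filler gives a lift that is compatible with the faces. Its values on `A_n` and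
on the degenerate simplices of `B_n` are already prescribed; the latter are covered by `A_n` and the
images, under the elementary degeneracies, of the complement of `A_{n-1}` in `B_{n-1}`. These
subobjects are complemented, the prescribed values agree on their intersections, and maps out of a
coproduct are determined by their restrictions to the summands, so the filler can be overwritten
there.

Conversely, a map `e : P ⟶ Q` is a complemented inclusion as soon as it lifts against the split
epimorphism `[e, 1] : P ⨿ Q ⟶ Q`: the lift `d : Q ⟶ P ⨿ Q` pulls the coproduct decomposition back
to `Q`, and the first summand is `e`. Evaluation in degree `n` has a right adjoint, the cofree
simplicial object, which sends split epimorphisms to enriched fibrations. Transposing the lifting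
problem along this adjunction shows that a cofibration is complemented in each degree. For the
relative condition at a degeneracy `s : [m] ⟶ [n]` one uses, for a split epimorphism `M ⟶ M'`, the
map from the cofree object on `M` in degree `m` to the pullback of the one on `M` in degree `n` and
the one on `M'` in degree `m`.
-/

section Coproducts

variable {E : Type u} [Category.{v} E]

/-- The maps `u` and `v` exhibit their codomain as a binary coproduct. -/
def IsCoprod {U V B : E} (u : U ⟶ B) (v : V ⟶ B) : Prop :=
  Nonempty (IsColimit (BinaryCofan.mk u v))

lemma IsCoprod.existsUnique_desc {U V B Y : E} {u : U ⟶ B} {v : V ⟶ B} (h : IsCoprod u v)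
    (f : U ⟶ Y) (g : V ⟶ Y) : ∃! d : B ⟶ Y, u ≫ d = f ∧ v ≫ d = g :=
  let hc := h.some
  ⟨hc.desc (BinaryCofan.mk f g), ⟨hc.fac (BinaryCofan.mk f g) ⟨.left⟩,
    hc.fac (BinaryCofan.mk f g) ⟨.right⟩⟩, fun _ hd ↦
    BinaryCofan.IsColimit.hom_ext hc
      (hd.1.trans (hc.fac (BinaryCofan.mk f g) ⟨.left⟩).symm)
      (hd.2.trans (hc.fac (BinaryCofan.mk f g) ⟨.right⟩).symm)⟩

lemma IsCoprod.hom_ext {U V B Y : E} {u : U ⟶ B} {v : V ⟶ B} (h : IsCoprod u v)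
    {f g : B ⟶ Y} (hu : u ≫ f = u ≫ g) (hv : v ≫ f = v ≫ g) : f = g :=
  BinaryCofan.IsColimit.hom_ext h.some hu hv

lemma isCoprod_iff_existsUnique_desc {U V B : E} {u : U ⟶ B} {v : V ⟶ B} :
    IsCoprod u v ↔
      ∀ ⦃Y : E⦄ (f : U ⟶ Y) (g : V ⟶ Y), ∃! d : B ⟶ Y, u ≫ d = f ∧ v ≫ d = g := by
  refine ⟨fun h Y ↦ h.existsUnique_desc, fun h ↦ ?_⟩
  choose d hd hd_unique using h
  exact ⟨BinaryCofan.IsColimit.mk _ (fun f g ↦ d f g) (fun f g ↦ (hd f g).1)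
    (fun f g ↦ (hd f g).2) fun f g m hf hg ↦ hd_unique f g m ⟨hf, hg⟩⟩

lemma IsCoprod.symm {U V B : E} {u : U ⟶ B} {v : V ⟶ B} (h : IsCoprod u v) : IsCoprod v u :=
  isCoprod_iff_existsUnique_desc.2 fun _ f g ↦ by
    simpa only [and_comm] using h.existsUnique_desc g f

lemma IsCoprod.of_isPullback [FinitaryExtensive E] {U V B Z U' V' : E}
    {u : U ⟶ B} {v : V ⟶ B} (h : IsCoprod u v) {b : Z ⟶ B} {u' : U' ⟶ Z} {v' : V' ⟶ Z}
    {r : U' ⟶ U} {s : V' ⟶ V} (hu : IsPullback u' r b u) (hv : IsPullback v' s b v) :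
    IsCoprod u' v' :=
  ((BinaryCofan.isVanKampen_iff _).1 (FinitaryExtensive.vanKampen _ h.some)
    (BinaryCofan.mk u' v') r s b hu.w.symm hv.w.symm).2 ⟨hu, hv⟩

lemma IsCoprod.pullback [FinitaryExtensive E] [HasPullbacks E] {U V B Z : E}
    {u : U ⟶ B} {v : V ⟶ B} (h : IsCoprod u v) (b : Z ⟶ B) :
    IsCoprod (pullback.fst b u) (pullback.fst b v) :=
  h.of_isPullback (.of_hasPullback _ _) (.of_hasPullback _ _)

lemma IsCoprod.of_isPushout {A B C A' P : E} {i : A ⟶ B} {j : C ⟶ B} {f : A ⟶ A'}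
    {inl : A' ⟶ P} {inr : B ⟶ P} (h : IsCoprod i j) (sq : IsPushout f i inl inr) :
    IsCoprod inl (j ≫ inr) := by
  refine isCoprod_iff_existsUnique_desc.2 fun Y g g' ↦ ?_
  obtain ⟨d, ⟨hid, hjd⟩, -⟩ := h.existsUnique_desc (f ≫ g) g'
  refine ⟨sq.desc g d hid.symm, ⟨by simp, by simp [hjd]⟩, fun m ⟨hm, hm'⟩ ↦ ?_⟩
  refine sq.hom_ext (by simp [hm]) (h.hom_ext ?_ (by simpa [hjd] using hm'))
  simp [hid, ← sq.w_assoc, hm]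

lemma isPushout_of_isCoprod {A B C A' P : E} {i : A ⟶ B} {j : C ⟶ B} {f : A ⟶ A'}
    {inl : A' ⟶ P} {inr : B ⟶ P} (h : IsCoprod i j) (h' : IsCoprod inl (j ≫ inr))
    (w : f ≫ inl = i ≫ inr) : IsPushout f i inl inr := by
  have exists_desc (s : PushoutCocone f i) := (h'.existsUnique_desc s.inl (j ≫ s.inr)).exists
  choose d hd hd' using exists_desc
  refine ⟨⟨w⟩, ⟨PushoutCocone.IsColimit.mk _ d hd (fun s ↦ h.hom_ext ?_ ?_)
    fun s m hm hm' ↦ h'.hom_ext ?_ ?_⟩⟩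
  · rw [← reassoc_of% w, hd, s.condition]
  · rw [← Category.assoc, hd']
  · rw [hm, hd]
  · rw [Category.assoc, hm', hd']

lemma IsComplementedInclusion.mono [FinitaryExtensive E] {A B : E} {i : A ⟶ B}
    (hi : IsComplementedInclusion i) : Mono i :=
  let ⟨_, _, ⟨hc⟩⟩ := hi
  FinitaryExtensive.mono_inl_of_isColimit hc

lemma IsComplementedInclusion.comp [HasBinaryCoproducts E] {A B D : E} {i : A ⟶ B} {j : B ⟶ D}
    (hi : IsComplementedInclusion i) (hj : IsComplementedInclusion j) :
    IsComplementedInclusion (i ≫ j) := by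
  obtain ⟨C, k, (h : IsCoprod i k)⟩ := hi
  obtain ⟨C', k', (h' : IsCoprod j k')⟩ := hj
  refine ⟨C ⨿ C', coprod.desc (k ≫ j) k', isCoprod_iff_existsUnique_desc.2 fun Y f g ↦ ?_⟩
  obtain ⟨d, ⟨hid, hkd⟩, -⟩ := h.existsUnique_desc f (coprod.inl ≫ g)
  obtain ⟨d', ⟨hjd, hkd'⟩, -⟩ := h'.existsUnique_desc d (coprod.inr ≫ g)
  refine ⟨d', ⟨by rw [Category.assoc, hjd, hid], ?_⟩, fun m ⟨hm, hm'⟩ ↦ ?_⟩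
  · ext <;> simp [hjd, hkd, hkd', coprod.inl_desc, coprod.inr_desc]
  · have hl := coprod.inl ≫= hm'
    have hr := coprod.inr ≫= hm'
    simp only [coprod.inl_desc_assoc, coprod.inr_desc_assoc, Category.assoc] at hl hr hm
    exact h'.hom_ext (hjd ▸ h.hom_ext (hm.trans hid.symm) (hl.trans hkd.symm)) (hr.trans hkd'.symm)

lemma IsComplementedInclusion.hasPushout [HasBinaryCoproducts E] {A B A' : E} {i : A ⟶ B}
    (hi : IsComplementedInclusion i) (f : A ⟶ A') : HasPushout f i := by
  obtain ⟨C, j, (h : IsCoprod i j)⟩ := hi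
  obtain ⟨d, ⟨hl, hr⟩, -⟩ := h.existsUnique_desc (f ≫ coprod.inl) (coprod.inr : C ⟶ A' ⨿ C)
  have hP : IsCoprod (coprod.inl : A' ⟶ A' ⨿ C) (j ≫ d) := hr ▸ ⟨coprodIsCoprod A' C⟩
  exact (isPushout_of_isCoprod h hP hl.symm).hasPushout

/-- A lift of `e` against the split epimorphism `[e, 1] : P ⨿ Q ⟶ Q` exhibits `e` as the pullback
of the coproduct inclusion `P ⟶ P ⨿ Q`. -/
lemma isComplementedInclusion_of_lift [FinitaryExtensive E] [HasPullbacks E] {P Q : E} (e : P ⟶ Q)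
    (d : Q ⟶ P ⨿ Q) (hed : e ≫ d = coprod.inl) (hd : d ≫ coprod.desc e (𝟙 Q) = 𝟙 Q) :
    IsComplementedInclusion e := by
  have sq : IsPullback e (𝟙 P) d coprod.inl := by
    refine ⟨⟨by simp [hed]⟩, ⟨PullbackCone.IsLimit.mk _ (fun s ↦ s.snd) (fun s ↦ ?_)
      (fun s ↦ Category.comp_id _) fun s m _ hm ↦ (Category.comp_id m).symm.trans hm⟩⟩
    simpa [hd, coprod.inl_desc] using (s.condition =≫ coprod.desc e (𝟙 Q)).symm
  have hcoprod : IsCoprod (coprod.inl : P ⟶ P ⨿ Q) coprod.inr := ⟨coprodIsCoprod P Q⟩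
  exact ⟨_, pullback.fst d coprod.inr, hcoprod.of_isPullback sq (.of_hasPullback _ _)⟩

instance [CountablyLextensive E] : FinitaryExtensive E where
  hasFiniteCoproducts := ⟨fun _ ↦ inferInstance⟩
  van_kampen' c hc := CountablyLextensive.isVanKampen _ _ c hc

end Coproducts

section Gluing

variable {E : Type u} [Category.{v} E] {D : Type*} [Category* D]

/-- The presheaf `B ↦ (J B ⟶ W)` on `E` sends binary coproducts to products, that is, it satisfies
the sheaf condition for binary covers in the extensive topology. -/
def IsExtensiveSheaf (J : E ⥤ D) (W : D) : Prop :=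
  ∀ ⦃U V B : E⦄ ⦃u : U ⟶ B⦄ ⦃v : V ⟶ B⦄, IsCoprod u v →
    ∀ (f : J.obj U ⟶ W) (g : J.obj V ⟶ W), ∃! d : J.obj B ⟶ W, J.map u ≫ d = f ∧ J.map v ≫ d = g

variable {J : E ⥤ D} {W : D}

lemma IsExtensiveSheaf.hom_ext (hW : IsExtensiveSheaf J W) {U V B : E} {u : U ⟶ B} {v : V ⟶ B}
    (h : IsCoprod u v) {f g : J.obj B ⟶ W} (hu : J.map u ≫ f = J.map u ≫ g)
    (hv : J.map v ≫ f = J.map v ≫ g) : f = g :=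
  (hW h _ _).unique ⟨hu, hv⟩ ⟨rfl, rfl⟩

variable [FinitaryExtensive E] [HasPullbacks E]

lemma IsExtensiveSheaf.exists_override (hW : IsExtensiveSheaf J W) {U B : E} {u : U ⟶ B}
    (hu : IsComplementedInclusion u) (F : J.obj U ⟶ W) (G : J.obj B ⟶ W) :
    ∃ H : J.obj B ⟶ W, J.map u ≫ H = F ∧
      (∀ ⦃R : E⦄ (r : R ⟶ B), (∀ ⦃Z : E⦄ (x : Z ⟶ U) (y : Z ⟶ R), x ≫ u = y ≫ r →
        J.map x ≫ F = J.map (y ≫ r) ≫ G) → J.map r ≫ H = J.map r ≫ G) ∧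
      ∀ ⦃W' : D⦄, IsExtensiveSheaf J W' → ∀ f : W ⟶ W', F ≫ f = J.map u ≫ G ≫ f →
        H ≫ f = G ≫ f := by
  obtain ⟨V, v, (h : IsCoprod u v)⟩ := hu
  obtain ⟨H, ⟨hHu, hHv⟩, -⟩ := hW h F (J.map v ≫ G)
  refine ⟨H, hHu, fun R r hFG ↦ hW.hom_ext (h.pullback r) ?_ ?_, fun W' hW' f hFG ↦ ?_⟩
  · rw [← J.map_comp_assoc, ← J.map_comp_assoc, ← hFG _ _ pullback.condition.symm,
      pullback.condition, J.map_comp_assoc, hHu]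
  · rw [← J.map_comp_assoc, ← J.map_comp_assoc, pullback.condition, J.map_comp_assoc, hHv,
      J.map_comp_assoc]
  · exact hW'.hom_ext h (by rw [reassoc_of% hHu, hFG]) (by rw [reassoc_of% hHv])

lemma IsExtensiveSheaf.exists_glue (hW : IsExtensiveSheaf J W) {B : E} (G : J.obj B ⟶ W)
    {ι : Type*} (s : Finset ι) {U : ι → E} {u : ∀ j, U j ⟶ B}
    (hu : ∀ j, IsComplementedInclusion (u j)) (F : ∀ j, J.obj (U j) ⟶ W)
    (hF : ∀ (j k : ι) ⦃Z : E⦄ (x : Z ⟶ U j) (y : Z ⟶ U k), x ≫ u j = y ≫ u k →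
      J.map x ≫ F j = J.map y ≫ F k) :
    ∃ H : J.obj B ⟶ W, (∀ j ∈ s, J.map (u j) ≫ H = F j) ∧
      ∀ ⦃W' : D⦄, IsExtensiveSheaf J W' → ∀ f : W ⟶ W',
        (∀ j, F j ≫ f = J.map (u j) ≫ G ≫ f) → H ≫ f = G ≫ f := by
  classical
  induction s using Finset.induction_on with
  | empty => exact ⟨G, by simp, fun _ _ _ _ ↦ rfl⟩
  | insert k s _ ih =>
    obtain ⟨H, hHs, hHG⟩ := ih
    obtain ⟨H', hH'k, hH'H, hH'f⟩ := hW.exists_override (hu k) (F k) H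
    refine ⟨H', fun j hj ↦ ?_, fun W' hW' f hf ↦ ?_⟩
    · rcases Finset.mem_insert.1 hj with rfl | hj
      · exact hH'k
      · rw [hH'H (u j) fun Z x y hxy ↦ ?_, hHs j hj]
        rw [hF k j x y hxy, J.map_comp_assoc, hHs j hj]
    · exact (hH'f hW' f (by rw [hHG hW' f hf, hf])).trans (hHG hW' f hf)

end Gluing

section Degeneracies

lemma exists_isSplitEpi_factorisation {m : SimplexCategory} {l : ℕ} (e : m ⟶ ⦋l⦌) :
    ∃ (k : ℕ) (_ : k ≤ l) (e' : m ⟶ ⦋k⦌) (μ : ⦋k⦌ ⟶ ⦋l⦌) (ν : ⦋k⦌ ⟶ m),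
      ν ≫ e' = 𝟙 _ ∧ e' ≫ μ = e := by
  have := isSplitEpi_of_epi (factorThruImage e)
  exact ⟨(image e).len, SimplexCategory.len_le_of_mono (image.ι e), factorThruImage e, image.ι e,
    section_ (factorThruImage e), IsSplitEpi.id _, image.fac e⟩

lemma exists_mono_factorisation_of_not_surjective {m : SimplexCategory} {n : ℕ} (α : m ⟶ ⦋n⦌)
    (hα : ¬ Function.Surjective α.toOrderHom) :
    ∃ (l : ℕ) (_ : l < n) (e : m ⟶ ⦋l⦌) (δ : ⦋l⦌ ⟶ ⦋n⦌), Mono δ ∧ e ≫ δ = α := by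
  cases n with
  | zero => exact (hα fun x ↦ ⟨0, Subsingleton.elim (α := Fin 1) _ _⟩).elim
  | succ n =>
    obtain ⟨i, θ, rfl⟩ := SimplexCategory.eq_comp_δ_of_not_surjective α hα
    exact ⟨n, n.lt_succ_self, θ, SimplexCategory.δ i, inferInstance, rfl⟩

lemma not_surjective_of_lt {m n : ℕ} (h : m < n) (α : ⦋m⦌ ⟶ ⦋n⦌) :
    ¬ Function.Surjective α.toOrderHom := fun hα ↦ by
  have := SimplexCategory.epi_iff_surjective.2 hα
  exact absurd (SimplexCategory.len_le_of_epi α) (by simpa using h)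

lemma not_injective_of_lt {m n : ℕ} (h : m < n) (α : ⦋n⦌ ⟶ ⦋m⦌) :
    ¬ Function.Injective α.toOrderHom := fun hα ↦ by
  have := SimplexCategory.mono_iff_injective.2 hα
  exact absurd (SimplexCategory.len_le_of_mono α) (by simpa using h)

lemma surjective_of_comp_eq_id {m n : SimplexCategory} {δ : n ⟶ m} {σ : m ⟶ n}
    (h : δ ≫ σ = 𝟙 n) : Function.Surjective σ.toOrderHom :=
  have : IsSplitEpi σ := ⟨⟨⟨δ, h⟩⟩⟩
  SimplexCategory.epi_iff_surjective.1 inferInstance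

/-- A finite family of split epimorphisms `σ j` out of `⦋n⦌` that generate the degenerate part of
degree `n` of a simplicial object. The last field makes it possible to compare two of them: it says
that one of the idempotents `σ j' ≫ δ j'` and `σ j ≫ δ j` maps the fibres of the other
degeneracy into each other. -/
structure DegeneracySystem (n : ℕ) where
  {ι : Type}
  [fintype : Fintype ι]
  dim : ι → ℕ
  dim_lt (j : ι) : dim j < n
  σ (j : ι) : ⦋n⦌ ⟶ ⦋dim j⦌
  δ (j : ι) : ⦋dim j⦌ ⟶ ⦋n⦌
  δ_comp_σ (j : ι) : δ j ≫ σ j = 𝟙 _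
  exists_fac {l : ℕ} (α : ⦋n⦌ ⟶ ⦋l⦌) (hα : ¬ Function.Injective α.toOrderHom) :
    ∃ (j : ι) (β : ⦋dim j⦌ ⟶ ⦋l⦌), α = σ j ≫ β
  exists_comm (j j' : ι) :
    (∃ r, σ j' ≫ δ j' ≫ σ j = σ j ≫ r) ∨ ∃ r, σ j ≫ δ j ≫ σ j' = σ j' ≫ r

attribute [instance] DegeneracySystem.fintype

lemma exists_σ_comp_δ_comp_σ_eq {n : ℕ} {i j : Fin (n + 1)} (h : i ≤ j) :
    ∃ r : ⦋n⦌ ⟶ ⦋n⦌, SimplexCategory.σ j ≫ SimplexCategory.δ j.succ ≫ SimplexCategory.σ i =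
      SimplexCategory.σ i ≫ r := by
  obtain rfl | h := h.eq_or_lt
  · exact ⟨𝟙 _, by rw [SimplexCategory.δ_comp_σ_succ]⟩
  · cases n with
    | zero => omega
    | succ n =>
      obtain ⟨i', rfl⟩ := Fin.eq_castSucc_of_ne_last (Fin.ne_last_of_lt h)
      obtain ⟨j', rfl⟩ := Fin.eq_succ_of_ne_zero (Fin.ne_zero_of_lt h)
      refine ⟨SimplexCategory.σ j' ≫ SimplexCategory.δ j'.succ, ?_⟩
      rw [SimplexCategory.δ_comp_σ_of_gt h, SimplexCategory.σ_comp_σ_assoc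
        (Fin.castSucc_lt_succ_iff.1 h)]

/-- The elementary degeneracies `σ j : ⦋n⦌ ⟶ ⦋n - 1⦌`. -/
def elementaryDegeneracies (n : ℕ) : DegeneracySystem n :=
  match n with
  | 0 =>
    { ι := Empty
      dim := Empty.elim
      dim_lt j := j.elim
      σ j := j.elim
      δ j := j.elim
      δ_comp_σ j := j.elim
      exists_fac _ hα := (hα fun _ _ _ ↦ Subsingleton.elim (α := Fin 1) _ _).elim
      exists_comm j := j.elim }
  | n + 1 =>
    { ι := Fin (n + 1)
      dim _ := n
      dim_lt _ := n.lt_succ_self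
      σ j := SimplexCategory.σ j
      δ j := SimplexCategory.δ j.succ
      δ_comp_σ _ := SimplexCategory.δ_comp_σ_succ
      exists_fac α hα := SimplexCategory.eq_σ_comp_of_not_injective α hα
      exists_comm i j :=
        (le_total i j).imp exists_σ_comp_δ_comp_σ_eq exists_σ_comp_δ_comp_σ_eq }

end Degeneracies

section PartialLifts

variable {D : Type*} [Category* D] {A B X Y : SimplicialObject D} {i : A ⟶ B} {p : X ⟶ Y}
  {top : A ⟶ X} {bot : B ⟶ Y}

/-- A lift in a commutative square of simplicial objects, defined in degrees `< n` only. -/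
structure PartialLift (sq : CommSq top i p bot) (n : ℕ) where
  app (k : ℕ) (hk : k < n) : B.obj (op ⦋k⦌) ⟶ X.obj (op ⦋k⦌)
  naturality {k l : ℕ} (hk : k < n) (hl : l < n) (α : ⦋k⦌ ⟶ ⦋l⦌) :
    B.map α.op ≫ app k hk = app l hl ≫ X.map α.op
  fac_left {k : ℕ} (hk : k < n) : i.app _ ≫ app k hk = top.app _
  fac_right {k : ℕ} (hk : k < n) : app k hk ≫ p.app _ = bot.app _

/-- Given a partial lift `L` in degrees `< n`, a map in degree `n` that extends it to a partial
lift in degrees `≤ n`. Endomorphisms of `⦋n⦌` need not be considered because they are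
identities or factor through a lower dimension. -/
structure PartialLift.IsExtension {sq : CommSq top i p bot} {n : ℕ} (L : PartialLift sq n)
    (H : B.obj (op ⦋n⦌) ⟶ X.obj (op ⦋n⦌)) : Prop where
  fac_left : i.app _ ≫ H = top.app _
  fac_right : H ≫ p.app _ = bot.app _
  map_from_lower ⦃k : ℕ⦄ (hk : k < n) (α : ⦋k⦌ ⟶ ⦋n⦌) : B.map α.op ≫ L.app k hk = H ≫ X.map α.op
  map_to_lower ⦃k : ℕ⦄ (hk : k < n) (α : ⦋n⦌ ⟶ ⦋k⦌) : B.map α.op ≫ H = L.app k hk ≫ X.map α.op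

namespace PartialLift

variable {sq : CommSq top i p bot} {n : ℕ} {L : PartialLift sq n}

lemma IsExtension.naturality {H : B.obj (op ⦋n⦌) ⟶ X.obj (op ⦋n⦌)} (hH : L.IsExtension H)
    (α : ⦋n⦌ ⟶ ⦋n⦌) : B.map α.op ≫ H = H ≫ X.map α.op := by
  by_cases hα : Function.Injective α.toOrderHom
  · have := SimplexCategory.mono_iff_injective.2 hα
    simp [SimplexCategory.eq_id_of_mono α]
  · obtain ⟨j, β, rfl⟩ := (elementaryDegeneracies n).exists_fac α hα
    have hj := (elementaryDegeneracies n).dim_lt j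
    rw [op_comp, B.map_comp, Category.assoc, hH.map_to_lower hj, ← Category.assoc,
      hH.map_from_lower hj, X.map_comp, Category.assoc]

lemma IsExtension.exists_partialLift {H : B.obj (op ⦋n⦌) ⟶ X.obj (op ⦋n⦌)}
    (hH : L.IsExtension H) :
    ∃ L' : PartialLift sq (n + 1), ∀ k (hk : k < n), L'.app k (by omega) = L.app k hk := by
  classical
  let app (k : ℕ) (hk : k < n + 1) : B.obj (op ⦋k⦌) ⟶ X.obj (op ⦋k⦌) :=
    if h : k < n then L.app k h else Nat.eq_of_lt_succ_of_not_lt hk h ▸ H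
  have app_of_lt {k : ℕ} (hk : k < n) : app k (by omega) = L.app k hk := dif_pos hk
  have app_self : app n n.lt_succ_self = H := dif_neg (lt_irrefl n)
  refine ⟨{ app, naturality {k l} hk hl α := ?_, fac_left {k} hk := ?_, fac_right {k} hk := ?_ },
    fun k hk ↦ app_of_lt hk⟩
  · rcases Nat.lt_succ_iff_lt_or_eq.1 hk with hk' | rfl <;>
      rcases Nat.lt_succ_iff_lt_or_eq.1 hl with hl' | rfl
    · rw [app_of_lt hk', app_of_lt hl', L.naturality]
    · rw [app_of_lt hk', app_self, hH.map_from_lower]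
    · rw [app_of_lt hl', app_self, hH.map_to_lower]
    · rw [app_self, hH.naturality]
  · rcases Nat.lt_succ_iff_lt_or_eq.1 hk with hk' | rfl
    · rw [app_of_lt hk', L.fac_left]
    · rw [app_self, hH.fac_left]
  · rcases Nat.lt_succ_iff_lt_or_eq.1 hk with hk' | rfl
    · rw [app_of_lt hk', L.fac_right]
    · rw [app_self, hH.fac_right]

lemma exists_boundary_value (L : PartialLift sq n) {m : SimplexCategory} (α : m ⟶ ⦋n⦌)
    (hα : ¬ Function.Surjective α.toOrderHom) :
    ∃ x : B.obj (op ⦋n⦌) ⟶ X.obj (op m),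
      ∀ (l : ℕ) (hl : l < n) (e : m ⟶ ⦋l⦌) (δ : ⦋l⦌ ⟶ ⦋n⦌), e ≫ δ = α →
        x = B.map δ.op ≫ L.app l hl ≫ X.map e.op := by
  obtain ⟨l₀, hl₀, e₀, δ₀, _, h₀⟩ := exists_mono_factorisation_of_not_surjective α hα
  refine ⟨B.map δ₀.op ≫ L.app l₀ hl₀ ≫ X.map e₀.op, fun l hl e δ h ↦ ?_⟩
  obtain ⟨k, hk, e', μ, ν, hν, he⟩ := exists_isSplitEpi_factorisation e
  have h_e₀ : e₀ = e' ≫ ν ≫ e₀ := by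
    rw [← cancel_mono δ₀, Category.assoc, Category.assoc, h₀, ← h, ← he, Category.assoc,
      reassoc_of% hν]
  have h_faces : (ν ≫ e₀) ≫ δ₀ = μ ≫ δ := by
    rw [Category.assoc, h₀, ← h, ← he, Category.assoc, reassoc_of% hν]
  have hkn := hk.trans_lt hl
  calc B.map δ₀.op ≫ L.app l₀ hl₀ ≫ X.map e₀.op
      = B.map δ₀.op ≫ (L.app l₀ hl₀ ≫ X.map (ν ≫ e₀).op) ≫ X.map e'.op := by
        rw [h_e₀, op_comp, X.map_comp, reassoc_of% hν, Category.assoc]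
    _ = B.map ((ν ≫ e₀) ≫ δ₀).op ≫ L.app k hkn ≫ X.map e'.op := by
        rw [← L.naturality hkn, op_comp (g := δ₀), B.map_comp, Category.assoc, Category.assoc]
    _ = B.map δ.op ≫ L.app l hl ≫ X.map (e' ≫ μ).op := by
        rw [h_faces, op_comp, B.map_comp, Category.assoc, ← Category.assoc (B.map μ.op),
          L.naturality hkn hl, Category.assoc, op_comp, X.map_comp]
    _ = B.map δ.op ≫ L.app l hl ≫ X.map e.op := by rw [he]

end PartialLift

lemma hasLift_of_forall_exists_isExtension (sq : CommSq top i p bot)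
    (h : ∀ (n : ℕ) (L : PartialLift sq n), ∃ H, L.IsExtension H) : sq.HasLift := by
  have exists_next (n : ℕ) (L : PartialLift sq n) :=
    let ⟨_, hH⟩ := h n L
    hH.exists_partialLift
  choose next hnext using exists_next
  let L (n : ℕ) : PartialLift sq n := Nat.rec
    { app _ hk := by simp at hk, naturality hk := by simp at hk, fac_left hk := by simp at hk
      fac_right hk := by simp at hk } next n
  let lift (k : ℕ) := (L (k + 1)).app k k.lt_succ_self
  have L_app {n k : ℕ} (hk : k < n) : (L n).app k hk = lift k := by
    induction n, hk using Nat.le_induction with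
    | base => rfl
    | succ n hk ih => exact (hnext n (L n) k hk).trans ih
  have naturality {k l : ℕ} (α : ⦋k⦌ ⟶ ⦋l⦌) : B.map α.op ≫ lift k = lift l ≫ X.map α.op := by
    have hk : k < max k l + 1 := by omega
    have hl : l < max k l + 1 := by omega
    rw [← L_app hk, ← L_app hl, (L (max k l + 1)).naturality]
  exact ⟨⟨{
    l := { app m := lift m.unop.len, naturality _ _ α := naturality α.unop }
    fac_left := by
      ext m
      exact (L (m.unop.len + 1)).fac_left m.unop.len.lt_succ_self
    fac_right := by
      ext m
      exact (L (m.unop.len + 1)).fac_right m.unop.len.lt_succ_self }⟩⟩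

/-- A map `W ⊗ ∂Δ[n] ⟶ X`, encoded by its components at the simplices of `∂Δ[n]`, that is, at the
non-surjective maps `α : m ⟶ ⦋n⦌`. -/
structure BoundaryMap (W : D) (X : SimplicialObject D) (n : ℕ) where
  app ⦃m : SimplexCategory⦄ (α : m ⟶ ⦋n⦌) (hα : ¬ Function.Surjective α.toOrderHom) :
    W ⟶ X.obj (op m)
  app_comp ⦃m m' : SimplexCategory⦄ (γ : m' ⟶ m) (α : m ⟶ ⦋n⦌)
    (hα : ¬ Function.Surjective α.toOrderHom) (hγα : ¬ Function.Surjective (γ ≫ α).toOrderHom) :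
    app (γ ≫ α) hγα = app α hα ≫ X.map γ.op

/-- The map `x : W ⊗ Δ[n] ⟶ X` extends `bd : W ⊗ ∂Δ[n] ⟶ X`. -/
def BoundaryMap.IsFilledBy {W : D} {n : ℕ} (bd : BoundaryMap W X n) (x : W ⟶ X.obj (op ⦋n⦌)) :
    Prop :=
  ∀ ⦃m : SimplexCategory⦄ (α : m ⟶ ⦋n⦌) (hα : ¬ Function.Surjective α.toOrderHom),
    x ≫ X.map α.op = bd.app α hα

/-- The composite of `bd : W ⊗ ∂Δ[n] ⟶ X` with `p` is the restriction of
`base : W ⊗ Δ[n] ⟶ Y`. -/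
def BoundaryMap.IsOver {W : D} {n : ℕ} (bd : BoundaryMap W X n) (p : X ⟶ Y)
    (base : W ⟶ Y.obj (op ⦋n⦌)) : Prop :=
  ∀ ⦃m : SimplexCategory⦄ (α : m ⟶ ⦋n⦌) (hα : ¬ Function.Surjective α.toOrderHom),
    bd.app α hα ≫ p.app (op m) = base ≫ Y.map α.op

/-- The lifting property of `p` against the boundary inclusion `W ⊗ ∂Δ[n] ⟶ W ⊗ Δ[n]`. -/
def HasBoundaryFillers (W : D) (p : X ⟶ Y) (n : ℕ) : Prop :=
  ∀ (bd : BoundaryMap W X n) (base : W ⟶ Y.obj (op ⦋n⦌)), bd.IsOver p base →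
    ∃ x : W ⟶ X.obj (op ⦋n⦌), x ≫ p.app (op ⦋n⦌) = base ∧ bd.IsFilledBy x

lemma PartialLift.exists_fill {sq : CommSq top i p bot} {n : ℕ} (L : PartialLift sq n)
    (hp : HasBoundaryFillers (B.obj (op ⦋n⦌)) p n) :
    ∃ G : B.obj (op ⦋n⦌) ⟶ X.obj (op ⦋n⦌), G ≫ p.app _ = bot.app _ ∧
      ∀ ⦃k : ℕ⦄ (hk : k < n) (α : ⦋k⦌ ⟶ ⦋n⦌), B.map α.op ≫ L.app k hk = G ≫ X.map α.op := by
  choose val hval using fun (m : SimplexCategory) (α : m ⟶ ⦋n⦌) ↦ L.exists_boundary_value α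
  let bd : BoundaryMap (B.obj (op ⦋n⦌)) X n :=
    { app := val
      app_comp m m' γ α hα hγα := by
        obtain ⟨l, hl, e, δ, _, rfl⟩ := exists_mono_factorisation_of_not_surjective α hα
        rw [hval _ _ hα l hl e δ rfl, hval _ _ hγα l hl (γ ≫ e) δ (Category.assoc _ _ _)]
        simp only [op_comp, X.map_comp, Category.assoc] }
  have bd_app {m : SimplexCategory} (α : m ⟶ ⦋n⦌) (hα) : bd.app α hα = val m α hα := rfl
  have bd_isOver : bd.IsOver p (bot.app _) := by
    intro m α hα
    obtain ⟨l, hl, e, δ, _, rfl⟩ := exists_mono_factorisation_of_not_surjective α hα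
    rw [bd_app, hval _ _ hα l hl e δ rfl, Category.assoc, Category.assoc, p.naturality,
      reassoc_of% L.fac_right hl, ← bot.naturality, ← bot.naturality, op_comp, B.map_comp,
      Category.assoc, bot.naturality]
  obtain ⟨G, hGbot, hGbd⟩ := hp bd _ bd_isOver
  refine ⟨G, hGbot, fun k hk α ↦ ?_⟩
  rw [hGbd α (not_surjective_of_lt hk α), bd_app, hval _ α _ k hk (𝟙 _) α (Category.id_comp _)]
  simp

end PartialLifts

section Extension

variable {E : Type u} [Category.{v} E] {D : Type*} [Category* D] {J : E ⥤ D}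
  {A B : SimplicialObject E} {i : A ⟶ B} {X Y : SimplicialObject D} {p : X ⟶ Y}
  {top : A ⋙ J ⟶ X} {bot : B ⋙ J ⟶ Y} {sq : CommSq top (Functor.whiskerRight i J) p bot} {n : ℕ}

lemma isComplementedInclusion_complement_comp_map [HasBinaryCoproducts E] {m n : SimplexCategory}
    {s : m ⟶ n} (hs : IsRelativelyComplementedAt i s) {C : E} {c : C ⟶ B.obj (op n)}
    (hc : IsCoprod (i.app (op n)) c) : IsComplementedInclusion (c ≫ B.map s.op) := by
  obtain ⟨_, hdesc⟩ := hs
  have hinr : IsComplementedInclusion (c ≫ pushout.inr (A.map s.op) (i.app (op n))) :=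
    ⟨_, _, (hc.of_isPushout (.of_hasPushout _ _)).symm⟩
  simpa only [Category.assoc, pushout.inr_desc] using hinr.comp hdesc

namespace PartialLift

lemma map_comp_top_eq_of_comp_eq (L : PartialLift sq n) [Mono (i.app (op ⦋n⦌))] {k : ℕ}
    (hk : k < n) {σ : ⦋n⦌ ⟶ ⦋k⦌} {δ : ⦋k⦌ ⟶ ⦋n⦌} (hδσ : δ ≫ σ = 𝟙 _) {Z : E}
    {a : Z ⟶ A.obj (op ⦋n⦌)} {b : Z ⟶ B.obj (op ⦋k⦌)} (h : a ≫ i.app _ = b ≫ B.map σ.op) :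
    J.map a ≫ top.app _ = J.map b ≫ L.app k hk ≫ X.map σ.op := by
  have hb : b = (a ≫ A.map δ.op) ≫ i.app _ := by
    rw [Category.assoc, i.naturality, reassoc_of% h, ← B.map_comp, ← op_comp, hδσ, op_id, B.map_id,
      Category.comp_id]
  have ha : (a ≫ A.map δ.op) ≫ A.map σ.op = a := by
    rw [← cancel_mono (i.app (op ⦋n⦌)), Category.assoc, i.naturality, ← Category.assoc, ← hb, h]
  have htop := top.naturality σ.op
  have hL := L.fac_left hk
  dsimp only [Functor.comp_map, Functor.whiskerRight_app] at htop hL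
  rw [hb, J.map_comp, Category.assoc, reassoc_of% hL, ← htop, ← J.map_comp_assoc, ha]

lemma map_comp_app_eq_of_comp_eq (L : PartialLift sq n) {k l : ℕ} (hk : k < n) (hl : l < n)
    {σ : ⦋n⦌ ⟶ ⦋k⦌} {δ : ⦋k⦌ ⟶ ⦋n⦌} (hδσ : δ ≫ σ = 𝟙 _)
    {σ' : ⦋n⦌ ⟶ ⦋l⦌} {δ' : ⦋l⦌ ⟶ ⦋n⦌} (hδσ' : δ' ≫ σ' = 𝟙 _)
    {r : ⦋k⦌ ⟶ ⦋k⦌} (hr : σ' ≫ δ' ≫ σ = σ ≫ r) {Z : E} {x : Z ⟶ B.obj (op ⦋k⦌)}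
    {y : Z ⟶ B.obj (op ⦋l⦌)} (h : x ≫ B.map σ.op = y ≫ B.map σ'.op) :
    J.map x ≫ L.app k hk ≫ X.map σ.op = J.map y ≫ L.app l hl ≫ X.map σ'.op := by
  have hB {k : ℕ} {σ : ⦋n⦌ ⟶ ⦋k⦌} {δ : ⦋k⦌ ⟶ ⦋n⦌} (hδσ : δ ≫ σ = 𝟙 _) :
      B.map σ.op ≫ B.map δ.op = 𝟙 _ := by
    rw [← B.map_comp, ← op_comp, hδσ, op_id, B.map_id]
  have hy : y = x ≫ B.map (δ' ≫ σ).op := by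
    rw [op_comp, B.map_comp, reassoc_of% h, hB hδσ', Category.comp_id]
  have hx : x ≫ B.map r.op = x := by
    have hr_eq : r = δ ≫ σ' ≫ δ' ≫ σ := by rw [hr, reassoc_of% hδσ]
    rw [hr_eq]
    simp only [op_comp, B.map_comp, Category.assoc]
    rw [reassoc_of% h, reassoc_of% hB hδσ', ← reassoc_of% h, hB hδσ, Category.comp_id]
  have hL := L.naturality hl hk (δ' ≫ σ)
  have hLr := L.naturality hk hk r
  dsimp only [Functor.comp_map] at hL hLr
  rw [hy, J.map_comp, Category.assoc, reassoc_of% hL, ← X.map_comp, ← op_comp, hr, op_comp,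
    X.map_comp, ← reassoc_of% hLr, ← J.map_comp_assoc, hx]

variable [FinitaryExtensive E] [HasPullbacks E]

lemma exists_glue (L : PartialLift sq n) (hX : ∀ k, IsExtensiveSheaf J (X.obj k))
    (hi : IsLevelwiseComplementedInclusion i) (S : DegeneracySystem n)
    (hS : ∀ j, IsRelativelyComplementedAt i (S.σ j))
    (G : J.obj (B.obj (op ⦋n⦌)) ⟶ X.obj (op ⦋n⦌)) :
    ∃ H : J.obj (B.obj (op ⦋n⦌)) ⟶ X.obj (op ⦋n⦌), J.map (i.app _) ≫ H = top.app _ ∧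
      (∀ j, J.map (B.map (S.σ j).op) ≫ H = L.app _ (S.dim_lt j) ≫ X.map (S.σ j).op) ∧
      ∀ ⦃W : D⦄, IsExtensiveSheaf J W → ∀ f : X.obj (op ⦋n⦌) ⟶ W,
        top.app _ ≫ f = J.map (i.app _) ≫ G ≫ f →
        (∀ j, L.app _ (S.dim_lt j) ≫ X.map (S.σ j).op ≫ f = J.map (B.map (S.σ j).op) ≫ G ≫ f) →
        H ≫ f = G ≫ f := by
  choose C c hc using fun m ↦ (hi m : ∃ C c, IsCoprod (i.app (op m)) c)
  have := (hi ⦋n⦌).mono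
  obtain ⟨H', hH'σ, hH'G⟩ := (hX (op ⦋n⦌)).exists_glue G Finset.univ
    (fun j ↦ isComplementedInclusion_complement_comp_map (hS j) (hc _))
    (fun j ↦ J.map (c _) ≫ L.app _ (S.dim_lt j) ≫ X.map (S.σ j).op) (fun j j' Z x y hxy ↦ by
      simp only [← Category.assoc] at hxy
      simp only [← J.map_comp_assoc]
      obtain ⟨r, hr⟩ | ⟨r, hr⟩ := S.exists_comm j j'
      · exact L.map_comp_app_eq_of_comp_eq _ _ (S.δ_comp_σ j) (S.δ_comp_σ j') hr hxy
      · exact (L.map_comp_app_eq_of_comp_eq _ _ (S.δ_comp_σ j') (S.δ_comp_σ j) hr hxy.symm).symm)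
  obtain ⟨H, hHi, hHH', hHf⟩ := (hX (op ⦋n⦌)).exists_override (hi ⦋n⦌) (top.app _) H'
  refine ⟨H, hHi, fun j ↦ (hX _).hom_ext (hc ⦋S.dim j⦌) ?_ ?_, fun W hW f htop hσ ↦ ?_⟩
  · rw [← J.map_comp_assoc, ← i.naturality, J.map_comp_assoc, hHi, ← Category.assoc]
    exact (top.naturality _).trans (congrArg (· ≫ X.map _) (L.fac_left _).symm)
  · rw [← J.map_comp_assoc, hHH' _ fun Z x y hxy ↦ ?_, hH'σ j (Finset.mem_univ j)]
    rw [J.map_comp_assoc, hH'σ j (Finset.mem_univ j), ← J.map_comp_assoc]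
    exact L.map_comp_top_eq_of_comp_eq _ (S.δ_comp_σ j) (hxy.trans (Category.assoc _ _ _).symm)
  · have hH' := hH'G hW f fun j ↦ by
      rw [Category.assoc, Category.assoc, hσ, J.map_comp_assoc]
    exact (hHf hW f (by rw [hH', htop])).trans hH'

lemma exists_isExtension (L : PartialLift sq n) (hX : ∀ k, IsExtensiveSheaf J (X.obj k))
    (hY : ∀ k, IsExtensiveSheaf J (Y.obj k)) (hi : IsLevelwiseComplementedInclusion i)
    (hs : ∀ ⦃m n : SimplexCategory⦄ (s : m ⟶ n), Function.Surjective s.toOrderHom →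
      IsRelativelyComplementedAt i s)
    (hp : HasBoundaryFillers (J.obj (B.obj (op ⦋n⦌))) p n) :
    ∃ H, L.IsExtension H := by
  let S := elementaryDegeneracies n
  obtain ⟨G, hGbot, hG⟩ := L.exists_fill hp
  obtain ⟨H, hHtop, hHσ, hHG⟩ := L.exists_glue hX hi S
    (fun j ↦ hs _ (surjective_of_comp_eq_id (S.δ_comp_σ j))) G
  have hHbot : H ≫ p.app _ = bot.app _ := by
    rw [hHG (hY _) (p.app _) ?_ fun j ↦ ?_, hGbot]
    · rw [hGbot]
      exact NatTrans.congr_app sq.w _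
    · rw [hGbot, p.naturality, reassoc_of% L.fac_right]
      exact (bot.naturality _).symm
  have hHface {k : ℕ} (hk : k < n) (α : ⦋k⦌ ⟶ ⦋n⦌) :
      (B ⋙ J).map α.op ≫ L.app k hk = H ≫ X.map α.op := by
    rw [hHG (hX _) (X.map α.op) ?_ fun j ↦ ?_, hG]
    · rw [← hG hk, ← top.naturality, ← L.fac_left hk]
      exact (Functor.whiskerRight i J).naturality_assoc _ _
    · rw [← hG hk, ← X.map_comp, ← op_comp, ← L.naturality, op_comp, Functor.map_comp,
        Category.assoc, Functor.comp_map]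
  refine ⟨H, hHtop, hHbot, fun k hk ↦ hHface hk, fun k hk α ↦ ?_⟩
  obtain ⟨j, β, rfl⟩ := S.exists_fac α (not_injective_of_lt hk α)
  rw [op_comp, Functor.map_comp, Category.assoc, Functor.comp_map _ _ (S.σ j).op, hHσ,
    ← Category.assoc, L.naturality _ hk, X.map_comp, Category.assoc]

end PartialLift

theorem hasLiftingProperty_of_isRelativelyComplementedAt [FinitaryExtensive E] [HasPullbacks E]
    (hi : IsLevelwiseComplementedInclusion i)
    (hs : ∀ ⦃m n : SimplexCategory⦄ (s : m ⟶ n), Function.Surjective s.toOrderHom →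
      IsRelativelyComplementedAt i s)
    (hX : ∀ k, IsExtensiveSheaf J (X.obj k)) (hY : ∀ k, IsExtensiveSheaf J (Y.obj k))
    (hp : ∀ n, HasBoundaryFillers (J.obj (B.obj (op ⦋n⦌))) p n) :
    HasLiftingProperty (Functor.whiskerRight i J) p where
  sq_hasLift sq := hasLift_of_forall_exists_isExtension sq
    fun n L ↦ L.exists_isExtension hX hY hi hs (hp n)

end Extension

section Transpose

variable {E : Type u} [Category.{v} E]

/-- The functor `B ↦ P × yoneda B` from `E` to presheaves on `E`. -/
def prodYoneda (P : Eᵒᵖ ⥤ Type v) : E ⥤ Eᵒᵖ ⥤ Type v where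
  obj B :=
    { obj Z := P.obj Z × (Z.unop ⟶ B)
      map t := ↾fun x ↦ (P.map t x.1, t.unop ≫ x.2) }
  map f := { app _ := ↾fun x ↦ (x.1, x.2 ≫ f) }

variable {P : Eᵒᵖ ⥤ Type v}

/-- The value of a map `P × yoneda B ⟶ yoneda X` at a pair of generalized elements. -/
def prodYonedaApp {B X : E} (f : (prodYoneda P).obj B ⟶ yoneda.obj X) {Z : E} (w : P.obj (op Z))
    (b : Z ⟶ B) : Z ⟶ X :=
  f.app (op Z) (w, b)

/-- Maps `P × yoneda B ⟶ yoneda X` in terms of their values at generalized elements. -/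
def prodYonedaHomMk {B X : E} (d : ∀ ⦃Z : E⦄, P.obj (op Z) → (Z ⟶ B) → (Z ⟶ X))
    (hd : ∀ ⦃Z Z' : E⦄ (t : Z' ⟶ Z) (w : P.obj (op Z)) (b : Z ⟶ B),
      d (P.map t.op w) (t ≫ b) = t ≫ d w b) : (prodYoneda P).obj B ⟶ yoneda.obj X where
  app Z := ↾fun x : P.obj Z × (Z.unop ⟶ B) ↦ d x.1 x.2
  naturality Z Z' t := by
    ext ⟨w, b⟩
    exact hd t.unop w b

lemma prodYoneda_hom_ext {B X : E} {f g : (prodYoneda P).obj B ⟶ yoneda.obj X}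
    (h : ∀ ⦃Z : E⦄ (w : P.obj (op Z)) (b : Z ⟶ B), prodYonedaApp f w b = prodYonedaApp g w b) :
    f = g := by
  ext Z ⟨w, b⟩
  exact h w b

lemma prodYonedaApp_map {B X : E} (f : (prodYoneda P).obj B ⟶ yoneda.obj X) {Z Z' : E}
    (t : Z' ⟶ Z) (w : P.obj (op Z)) (b : Z ⟶ B) :
    prodYonedaApp f (P.map t.op w) (t ≫ b) = t ≫ prodYonedaApp f w b :=
  ConcreteCategory.congr_hom (f.naturality t.op) ((w, b) : P.obj (op Z) × (Z ⟶ B))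

lemma prodYonedaApp_map_comp {B B' X : E} (u : B' ⟶ B) (f : (prodYoneda P).obj B ⟶ yoneda.obj X)
    {Z : E} (w : P.obj (op Z)) (b : Z ⟶ B') :
    prodYonedaApp ((prodYoneda P).map u ≫ f) w b = prodYonedaApp f w (b ≫ u) :=
  rfl

lemma exists_app_of_isCoprod [FinitaryExtensive E] [HasPullbacks E] {U V B X : E} {u : U ⟶ B}
    {v : V ⟶ B} (h : IsCoprod u v) (f : (prodYoneda P).obj U ⟶ yoneda.obj X)
    (g : (prodYoneda P).obj V ⟶ yoneda.obj X) {Z : E} (w : P.obj (op Z)) (b : Z ⟶ B) :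
    ∃ d : Z ⟶ X,
      (∀ ⦃Z' : E⦄ (t : Z' ⟶ Z) (x : Z' ⟶ U), t ≫ b = x ≫ u →
        t ≫ d = prodYonedaApp f (P.map t.op w) x) ∧
      (∀ ⦃Z' : E⦄ (t : Z' ⟶ Z) (x : Z' ⟶ V), t ≫ b = x ≫ v →
        t ≫ d = prodYonedaApp g (P.map t.op w) x) := by
  obtain ⟨d, ⟨hu, hv⟩, -⟩ := (h.pullback b).existsUnique_desc
    (prodYonedaApp f (P.map (pullback.fst b u).op w) (pullback.snd b u))
    (prodYonedaApp g (P.map (pullback.fst b v).op w) (pullback.snd b v))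
  refine ⟨d, fun Z' t x hx ↦ ?_, fun Z' t x hx ↦ ?_⟩
  · have hd := pullback.lift t x hx ≫= hu
    rwa [pullback.lift_fst_assoc, ← prodYonedaApp_map, pullback.lift_snd,
      ← ConcreteCategory.comp_apply, ← P.map_comp, ← op_comp, pullback.lift_fst] at hd
  · have hd := pullback.lift t x hx ≫= hv
    rwa [pullback.lift_fst_assoc, ← prodYonedaApp_map, pullback.lift_snd,
      ← ConcreteCategory.comp_apply, ← P.map_comp, ← op_comp, pullback.lift_fst] at hd

lemma isExtensiveSheaf_yoneda [FinitaryExtensive E] [HasPullbacks E] (P : Eᵒᵖ ⥤ Type v) (X : E) :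
    IsExtensiveSheaf (prodYoneda P) (yoneda.obj X) := by
  intro U V B u v h f g
  choose d hdu hdv using fun {Z} ↦ exists_app_of_isCoprod (Z := Z) h f g
  have d_map ⦃Z Z' : E⦄ (t : Z' ⟶ Z) (w : P.obj (op Z)) (b : Z ⟶ B) :
      d (P.map t.op w) (t ≫ b) = t ≫ d w b := by
    refine (h.pullback (t ≫ b)).hom_ext ?_ ?_
    · rw [hdu _ _ _ _ pullback.condition, ← Category.assoc, hdu w b _ (pullback.snd (t ≫ b) u)
        (by rw [Category.assoc, pullback.condition])]
      simp
    · rw [hdv _ _ _ _ pullback.condition, ← Category.assoc, hdv w b _ (pullback.snd (t ≫ b) v)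
        (by rw [Category.assoc, pullback.condition])]
      simp
  refine ⟨prodYonedaHomMk (fun _ w b ↦ d w b) d_map, ⟨prodYoneda_hom_ext fun Z w x ↦ ?_,
    prodYoneda_hom_ext fun Z w x ↦ ?_⟩, fun d' ⟨hu, hv⟩ ↦ prodYoneda_hom_ext fun Z w b ↦ ?_⟩
  · have := hdu w (x ≫ u) (𝟙 Z) x (Category.id_comp _)
    rwa [Category.id_comp, op_id, P.map_id] at this
  · have := hdv w (x ≫ v) (𝟙 Z) x (Category.id_comp _)
    rwa [Category.id_comp, op_id, P.map_id] at this
  · refine (h.pullback b).hom_ext ?_ ?_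
    · refine Eq.trans ?_ (hdu w b _ _ pullback.condition).symm
      rw [← prodYonedaApp_map, pullback.condition, ← hu, prodYonedaApp_map_comp]
    · refine Eq.trans ?_ (hdv w b _ _ pullback.condition).symm
      rw [← prodYonedaApp_map, pullback.condition, ← hv, prodYonedaApp_map_comp]

variable {A B X Y : SimplicialObject E}

lemma prodYonedaApp_app (F : A ⋙ prodYoneda P ⟶ X ⋙ yoneda) {n n' : SimplexCategoryᵒᵖ}
    (α : n ⟶ n') {Z : E} (w : P.obj (op Z)) (b : Z ⟶ A.obj n) :
    prodYonedaApp (F.app n') w (b ≫ A.map α) = prodYonedaApp (F.app n) w b ≫ X.map α :=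
  ConcreteCategory.congr_hom (NatTrans.congr_app (F.naturality α) (op Z))
    ((w, b) : P.obj (op Z) × (Z ⟶ A.obj n))

variable [HasFiniteLimits E]

/-- The components of the map `Z × A ⟶ X` that corresponds to a section `w` of `P`. -/
def homPshApp (φ : P ⟶ homPsh A X) {Z : E} (w : P.obj (op Z)) (n : SimplexCategoryᵒᵖ) :
    Z ⨯ A.obj n ⟶ X.obj n :=
  NatTrans.app (φ.app (op Z) w : tensor Z A ⟶ X) n

lemma homPshApp_map (φ : P ⟶ homPsh A X) {Z Z' : E} (t : Z' ⟶ Z) (w : P.obj (op Z))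
    (n : SimplexCategoryᵒᵖ) :
    homPshApp φ (P.map t.op w) n = prod.map t (𝟙 (A.obj n)) ≫ homPshApp φ w n :=
  NatTrans.congr_app (ConcreteCategory.congr_hom (φ.naturality t.op) w :) n

lemma map_comp_homPshApp (φ : P ⟶ homPsh A X) {Z : E} (w : P.obj (op Z))
    {n n' : SimplexCategoryᵒᵖ} (α : n ⟶ n') :
    prod.map (𝟙 Z) (A.map α) ≫ homPshApp φ w n' = homPshApp φ w n ≫ X.map α :=
  NatTrans.naturality (φ.app (op Z) w : tensor Z A ⟶ X) α

lemma homPsh_hom_ext {φ ψ : P ⟶ homPsh A X}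
    (h : ∀ ⦃Z : E⦄ (w : P.obj (op Z)) (n : SimplexCategoryᵒᵖ),
      homPshApp φ w n = homPshApp ψ w n) : φ = ψ := by
  ext Z w
  exact NatTrans.ext (funext (h w))

/-- The components of the map `Z × A ⟶ X` obtained from `F : P × A ⟶ X` by fixing a section `w` of
`P` over `Z`. -/
def partialApp (F : A ⋙ prodYoneda P ⟶ X ⋙ yoneda) {Z : E} (w : P.obj (op Z))
    (n : SimplexCategoryᵒᵖ) : Z ⨯ A.obj n ⟶ X.obj n :=
  prodYonedaApp (F.app n) (P.map (prod.fst : Z ⨯ A.obj n ⟶ Z).op w) prod.snd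

lemma map_comp_partialApp (F : A ⋙ prodYoneda P ⟶ X ⋙ yoneda) {Z : E} (w : P.obj (op Z))
    {n n' : SimplexCategoryᵒᵖ} (α : n ⟶ n') :
    prod.map (𝟙 Z) (A.map α) ≫ partialApp F w n' = partialApp F w n ≫ X.map α := by
  refine Eq.trans ?_ (prodYonedaApp_app F α _ _)
  rw [partialApp, ← prodYonedaApp_map, ← ConcreteCategory.comp_apply, ← P.map_comp, ← op_comp,
    prod.map_fst, prod.map_snd, Category.comp_id]

lemma partialApp_map (F : A ⋙ prodYoneda P ⟶ X ⋙ yoneda) {Z Z' : E} (t : Z' ⟶ Z)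
    (w : P.obj (op Z)) (n : SimplexCategoryᵒᵖ) :
    partialApp F (P.map t.op w) n = prod.map t (𝟙 (A.obj n)) ≫ partialApp F w n := by
  rw [partialApp, partialApp, ← prodYonedaApp_map, ← ConcreteCategory.comp_apply,
    ← ConcreteCategory.comp_apply, ← P.map_comp, ← P.map_comp, ← op_comp, ← op_comp, prod.map_fst,
    prod.map_snd, Category.comp_id]

lemma lift_comp_partialApp (F : A ⋙ prodYoneda P ⟶ X ⋙ yoneda) {Z : E} (w : P.obj (op Z))
    {n : SimplexCategoryᵒᵖ} (b : Z ⟶ A.obj n) :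
    prod.lift (𝟙 Z) b ≫ partialApp F w n = prodYonedaApp (F.app n) w b := by
  rw [partialApp, ← prodYonedaApp_map, ← ConcreteCategory.comp_apply, ← P.map_comp, ← op_comp,
    prod.lift_fst, prod.lift_snd, op_id, P.map_id]
  rfl

/-- A map `P ⟶ Hom(A, X)` of presheaves is the same as a map `P × A ⟶ X` of simplicial presheaves,
where `A` and `X` are embedded by Yoneda. -/
def homPshEquiv : (P ⟶ homPsh A X) ≃ (A ⋙ prodYoneda P ⟶ X ⋙ yoneda) where
  toFun φ :=
    { app n := prodYonedaHomMk (fun Z w b ↦ prod.lift (𝟙 Z) b ≫ homPshApp φ w n)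
        fun Z Z' t w b ↦ by simp [homPshApp_map, prod.lift_map_assoc, prod.comp_lift_assoc]
      naturality n n' α := prodYoneda_hom_ext fun Z w b ↦
        (by simp [← map_comp_homPshApp, prod.lift_map_assoc] :
          prod.lift (𝟙 Z) (b ≫ A.map α) ≫ homPshApp φ w n' =
            (prod.lift (𝟙 Z) b ≫ homPshApp φ w n) ≫ X.map α) }
  invFun F :=
    { app Z := ↾fun w ↦
        { app := partialApp F w
          naturality _ _ α := map_comp_partialApp F w α }
      naturality _ _ t := by
        ext w
        exact NatTrans.ext (funext (partialApp_map F t.unop w)) }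
  left_inv φ := homPsh_hom_ext fun Z w n ↦ by
    change prod.lift (𝟙 _) prod.snd ≫ homPshApp φ (P.map prod.fst.op w) n = homPshApp φ w n
    simp [homPshApp_map, prod.lift_map_assoc]
  right_inv F := NatTrans.ext (funext fun _ ↦ prodYoneda_hom_ext fun _ w b ↦
    lift_comp_partialApp F w b)

variable (A) in
/-- The map `Hom(A, X) ⟶ Hom(A, Y)` given by composition with `p`. -/
def homPshPostcomp (p : X ⟶ Y) : homPsh A X ⟶ homPsh A Y where
  app Z := ↾fun u : tensor Z.unop A ⟶ X ↦ u ≫ p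
  naturality Z Z' t := by
    ext u
    exact (Category.assoc _ _ _)

variable (X) in
/-- The map `Hom(B, X) ⟶ Hom(A, X)` given by composition with `i`. -/
def homPshPrecomp (i : A ⟶ B) : homPsh B X ⟶ homPsh A X where
  app Z := ↾fun u : tensor Z.unop B ⟶ X ↦ tensorMapRight Z.unop i ≫ u
  naturality Z Z' t := by
    ext (u : tensor Z.unop B ⟶ X)
    exact ((Category.assoc _ _ _).symm.trans
      (congrArg (· ≫ u) (tensorMapLeft_comp_tensorMapRight t.unop i).symm)).trans
        (Category.assoc _ _ _)

lemma homPshEquiv_comp_homPshPostcomp (φ : P ⟶ homPsh A X) (p : X ⟶ Y) :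
    homPshEquiv (φ ≫ homPshPostcomp A p) = homPshEquiv φ ≫ Functor.whiskerRight p yoneda :=
  NatTrans.ext (funext fun _ ↦ prodYoneda_hom_ext fun _ _ _ ↦ (Category.assoc _ _ _).symm)

lemma homPshEquiv_comp_homPshPrecomp (φ : P ⟶ homPsh B X) (i : A ⟶ B) :
    homPshEquiv (φ ≫ homPshPrecomp X i) =
      Functor.whiskerRight i (prodYoneda P) ≫ homPshEquiv φ :=
  NatTrans.ext (funext fun n ↦ prodYoneda_hom_ext fun Z w b ↦
    (by simp [prod.lift_map_assoc] :
      prod.lift (𝟙 Z) b ≫ prod.map (𝟙 Z) (i.app n) ≫ homPshApp φ w n =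
        prod.lift (𝟙 Z) (b ≫ i.app n) ≫ homPshApp φ w n))

/-- The projection from lifting problems to their upper maps. -/
def probPshFst (i : A ⟶ B) (p : X ⟶ Y) : probPsh i p ⟶ homPsh A X where
  app _ := ↾fun w ↦ w.1.1

/-- The projection from lifting problems to their lower maps. -/
def probPshSnd (i : A ⟶ B) (p : X ⟶ Y) : probPsh i p ⟶ homPsh B Y where
  app _ := ↾fun w ↦ w.1.2

lemma probPsh_condition (i : A ⟶ B) (p : X ⟶ Y) :
    probPshFst i p ≫ homPshPostcomp A p = probPshSnd i p ≫ homPshPrecomp Y i := by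
  ext Z w
  exact w.2

/-- The universal property of the presheaf of lifting problems as a pullback. -/
def probPshLift {i : A ⟶ B} {p : X ⟶ Y} (f : P ⟶ homPsh A X) (g : P ⟶ homPsh B Y)
    (h : f ≫ homPshPostcomp A p = g ≫ homPshPrecomp Y i) : P ⟶ probPsh i p where
  app Z := ↾fun w ↦ ⟨(f.app Z w, g.app Z w), ConcreteCategory.congr_hom (NatTrans.congr_app h Z) w⟩
  naturality _ _ t := by
    ext w
    refine Subtype.ext (Prod.ext ?_ ?_)
    · exact ConcreteCategory.congr_hom (f.naturality t) w
    · exact ConcreteCategory.congr_hom (g.naturality t) w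

lemma hasEnrichedLiftingProperty_iff_forall_exists (i : A ⟶ B) (p : X ⟶ Y) :
    HasEnrichedLiftingProperty i p ↔
      ∀ ⦃P : Eᵒᵖ ⥤ Type v⦄ (f : P ⟶ homPsh A X) (g : P ⟶ homPsh B Y),
        f ≫ homPshPostcomp A p = g ≫ homPshPrecomp Y i →
          ∃ d : P ⟶ homPsh B X, d ≫ homPshPrecomp X i = f ∧ d ≫ homPshPostcomp B p = g := by
  refine ⟨fun ⟨⟨d, hd⟩⟩ P f g h ↦ ⟨probPshLift f g h ≫ d, ?_, ?_⟩, fun h ↦ ?_⟩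
  · exact congr(probPshLift f g h ≫ $hd ≫ probPshFst i p)
  · exact congr(probPshLift f g h ≫ $hd ≫ probPshSnd i p)
  · obtain ⟨d, hi, hp⟩ := h _ _ (probPsh_condition i p)
    refine ⟨⟨d, ?_⟩⟩
    ext Z w
    refine Subtype.ext (Prod.ext ?_ ?_)
    · exact ConcreteCategory.congr_hom (NatTrans.congr_app hi Z) w
    · exact ConcreteCategory.congr_hom (NatTrans.congr_app hp Z) w

lemma hasEnrichedLiftingProperty_iff (i : A ⟶ B) (p : X ⟶ Y) :
    HasEnrichedLiftingProperty i p ↔ ∀ P : Eᵒᵖ ⥤ Type v,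
      HasLiftingProperty (Functor.whiskerRight i (prodYoneda P))
        (Functor.whiskerRight p yoneda) := by
  rw [hasEnrichedLiftingProperty_iff_forall_exists]
  refine ⟨fun h P ↦ ⟨fun {f g} sq ↦ ?_⟩, fun h P f g hfg ↦ ?_⟩
  · obtain ⟨d, hi, hp⟩ := h (homPshEquiv.symm f) (homPshEquiv.symm g) (homPshEquiv.injective (by
      rw [homPshEquiv_comp_homPshPostcomp, homPshEquiv_comp_homPshPrecomp,
        Equiv.apply_symm_apply, Equiv.apply_symm_apply, sq.w]))
    refine ⟨⟨⟨homPshEquiv d, ?_, ?_⟩⟩⟩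
    · rw [← homPshEquiv_comp_homPshPrecomp, hi, Equiv.apply_symm_apply]
    · rw [← homPshEquiv_comp_homPshPostcomp, hp, Equiv.apply_symm_apply]
  · have := h P
    have sq : CommSq (homPshEquiv f) (Functor.whiskerRight i (prodYoneda P))
        (Functor.whiskerRight p yoneda) (homPshEquiv g) :=
      ⟨by rw [← homPshEquiv_comp_homPshPostcomp, ← homPshEquiv_comp_homPshPrecomp, hfg]⟩
    refine ⟨homPshEquiv.symm sq.lift, homPshEquiv.injective ?_, homPshEquiv.injective ?_⟩
    · rw [homPshEquiv_comp_homPshPrecomp, Equiv.apply_symm_apply, sq.fac_left]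
    · rw [homPshEquiv_comp_homPshPostcomp, Equiv.apply_symm_apply, sq.fac_right]

end Transpose

section Discrete

variable {E : Type u} [Category.{v} E] [CountablyLextensive E]

/-- The inclusion of the summand of `T × ∐_J 1 ≅ ∐_J T` indexed by `j`. -/
def prodSigmaι (T : E) {J : Type} [Countable J] (j : J) : T ⟶ T ⨯ ∐ fun _ : J ↦ ⊤_ E :=
  prod.lift (𝟙 T) (terminal.from T ≫ Sigma.ι (fun _ : J ↦ ⊤_ E) j)

lemma isPullback_prodSigmaι (T : E) {J : Type} [Countable J] (j : J) :
    IsPullback (prodSigmaι T j) (terminal.from T) prod.snd (Sigma.ι (fun _ : J ↦ ⊤_ E) j) := by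
  refine ⟨⟨prod.lift_snd _ _⟩, ⟨PullbackCone.IsLimit.mk _ (fun s ↦ s.fst ≫ prod.fst)
    (fun s ↦ ?_) (fun s ↦ Subsingleton.elim _ _) (fun s m h _ ↦ ?_)⟩⟩
  · apply Limits.prod.hom_ext
    · rw [Category.assoc, prodSigmaι, prod.lift_fst, Category.comp_id]
    · rw [s.condition, Category.assoc, Category.assoc, prodSigmaι, prod.lift_snd,
        ← Category.assoc, ← Category.assoc, Subsingleton.elim (_ ≫ terminal.from T)]
  · rw [← h, Category.assoc, prodSigmaι, prod.lift_fst, Category.comp_id]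

lemma nonempty_isColimit_prodSigmaι (T : E) (J : Type) [Countable J] :
    Nonempty (IsColimit (Cofan.mk (T ⨯ ∐ fun _ : J ↦ ⊤_ E) (prodSigmaι T (J := J)))) :=
  (CountablyLextensive.isVanKampen J _ _ (coproductIsCoproduct fun _ : J ↦ ⊤_ E)).isUniversal
    (Cofan.mk (T ⨯ ∐ fun _ : J ↦ ⊤_ E) (prodSigmaι T (J := J)))
    (Discrete.natTrans fun _ ↦ terminal.from T) prod.snd
    (by
      ext ⟨j⟩
      exact (isPullback_prodSigmaι T j).w.symm)
    (NatTrans.Equifibered.of_discrete _)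
    (fun ⟨j⟩ ↦ isPullback_prodSigmaι T j)

lemma prodSigma_hom_ext {T Y : E} {J : Type} [Countable J] {f g : (T ⨯ ∐ fun _ : J ↦ ⊤_ E) ⟶ Y}
    (h : ∀ j, prodSigmaι T j ≫ f = prodSigmaι T j ≫ g) : f = g :=
  Cofan.IsColimit.hom_ext (nonempty_isColimit_prodSigmaι T J).some _ _ h

lemma exists_prodSigma_desc {T Y : E} {J : Type} [Countable J] (φ : J → (T ⟶ Y)) :
    ∃ d : (T ⨯ ∐ fun _ : J ↦ ⊤_ E) ⟶ Y, ∀ j, prodSigmaι T j ≫ d = φ j :=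
  ⟨Cofan.IsColimit.desc (nonempty_isColimit_prodSigmaι T J).some φ,
    Cofan.IsColimit.fac (nonempty_isColimit_prodSigmaι T J).some φ⟩

lemma prodSigmaι_map (T : E) {J J' : Type} [Countable J] [Countable J'] (k : J → J') (j : J) :
    prodSigmaι T j ≫ prod.map (𝟙 T) (Sigma.map' k fun _ ↦ 𝟙 (⊤_ E)) = prodSigmaι T (k j) := by
  apply Limits.prod.hom_ext <;> simp [prodSigmaι]

lemma prodSigmaι_naturality {S T : E} (t : S ⟶ T) {J : Type} [Countable J] (j : J) :
    prodSigmaι S j ≫ prod.map t (𝟙 _) = t ≫ prodSigmaι T j := by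
  apply Limits.prod.hom_ext <;> simp [prodSigmaι, ← Category.assoc]

variable {K L : SSet.{0}} [∀ n, Countable (K.obj n)] [∀ n, Countable (L.obj n)]
  {P : Eᵒᵖ ⥤ Type v} {X Y : SimplicialObject E}

variable (X) in
/-- Evaluation of maps `T × K ⟶ X` at a simplex of `K`. -/
def evalSimplex {m : SimplexCategoryᵒᵖ} (k : K.obj m) :
    homPsh (discreteObj E K) X ⟶ yoneda.obj (X.obj m) where
  app T := ↾fun f : tensor T.unop (discreteObj E K) ⟶ X ↦ prodSigmaι T.unop k ≫ f.app m
  naturality S T t := by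
    ext (f : tensor S.unop (discreteObj E K) ⟶ X)
    exact ((Category.assoc _ _ _).symm.trans
      congr($(prodSigmaι_naturality t.unop k) ≫ f.app m)).trans (Category.assoc _ _ _)

lemma evalSimplex_hom_ext {f g : P ⟶ homPsh (discreteObj E K) X}
    (h : ∀ (m : SimplexCategoryᵒᵖ) (k : K.obj m), f ≫ evalSimplex X k = g ≫ evalSimplex X k) :
    f = g := by
  ext T w
  exact NatTrans.ext (funext fun m ↦ prodSigma_hom_ext fun k ↦
    ConcreteCategory.congr_hom (NatTrans.congr_app (h m k) T) w)

lemma evalSimplex_map {m m' : SimplexCategoryᵒᵖ} (α : m ⟶ m') (k : K.obj m) :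
    evalSimplex X (K.map α k) = evalSimplex X k ≫ yoneda.map (X.map α) := by
  ext T (f : tensor T.unop (discreteObj E K) ⟶ X)
  calc prodSigmaι T.unop (K.map α k) ≫ f.app m'
      = prodSigmaι T.unop k ≫ (tensor T.unop (discreteObj E K)).map α ≫ f.app m' :=
        congr($(prodSigmaι_map T.unop (K.map α) k) ≫ f.app m').symm.trans (Category.assoc _ _ _)
    _ = (prodSigmaι T.unop k ≫ f.app m) ≫ X.map α :=
        congr(prodSigmaι T.unop k ≫ $(f.naturality α)).trans (Category.assoc _ _ _).symm

lemma homPshPostcomp_evalSimplex (p : X ⟶ Y) {m : SimplexCategoryᵒᵖ} (k : K.obj m) :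
    homPshPostcomp (discreteObj E K) p ≫ evalSimplex Y k =
      evalSimplex X k ≫ yoneda.map (p.app m) := by
  ext T f
  exact (Category.assoc _ _ _).symm

lemma homPshPrecomp_evalSimplex (g : K ⟶ L) {m : SimplexCategoryᵒᵖ} (k : K.obj m) :
    homPshPrecomp X (discreteMap E g) ≫ evalSimplex X k = evalSimplex X (g.app m k) := by
  ext T (f : tensor T.unop (discreteObj E L) ⟶ X)
  exact (Category.assoc _ _ _).symm.trans congr($(prodSigmaι_map T.unop (g.app m) k) ≫ f.app m)

lemma exists_comp_evalSimplex_eq (φ : ∀ m : SimplexCategoryᵒᵖ, K.obj m → (P ⟶ yoneda.obj (X.obj m)))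
    (hφ : ∀ ⦃m m' : SimplexCategoryᵒᵖ⦄ (α : m ⟶ m') (k : K.obj m),
      φ m' (K.map α k) = φ m k ≫ yoneda.map (X.map α)) :
    ∃ f : P ⟶ homPsh (discreteObj E K) X, ∀ (m : SimplexCategoryᵒᵖ) (k : K.obj m),
      f ≫ evalSimplex X k = φ m k := by
  have hf (T : Eᵒᵖ) (w : P.obj T) (m : SimplexCategoryᵒᵖ) :
      ∃ f : (T.unop ⨯ ∐ fun _ : K.obj m ↦ ⊤_ E) ⟶ X.obj m,
        ∀ k : K.obj m, prodSigmaι T.unop k ≫ f = (φ m k).app T w :=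
    exists_prodSigma_desc fun k ↦ (φ m k).app T w
  choose f hf using hf
  have f_naturality (T : Eᵒᵖ) (w : P.obj T) ⦃m m' : SimplexCategoryᵒᵖ⦄ (α : m ⟶ m') :
      (tensor T.unop (discreteObj E K)).map α ≫ f T w m' = f T w m ≫ X.map α := by
    refine prodSigma_hom_ext fun k ↦ ?_
    calc prodSigmaι T.unop k ≫ (tensor T.unop (discreteObj E K)).map α ≫ f T w m'
        = prodSigmaι T.unop (K.map α k) ≫ f T w m' :=
          (Category.assoc _ _ _).symm.trans
            congr($(prodSigmaι_map T.unop (K.map α) k) ≫ f T w m')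
      _ = (φ m k).app T w ≫ X.map α := by
          rw [hf, hφ]
          rfl
      _ = prodSigmaι T.unop k ≫ f T w m ≫ X.map α := by rw [← hf, Category.assoc]
  refine ⟨{ app T := ↾fun w ↦ { app := f T w, naturality _ _ α := f_naturality T w α }
            naturality S T t := ?_ }, fun m k ↦ ?_⟩
  · ext w
    refine NatTrans.ext (funext fun m ↦ prodSigma_hom_ext fun k ↦ (hf T _ m k).trans ?_)
    calc (φ m k).app T (P.map t w)
        = t.unop ≫ (φ m k).app S w := ConcreteCategory.congr_hom ((φ m k).naturality t) w
      _ = t.unop ≫ prodSigmaι S.unop k ≫ f S w m := by rw [hf]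
      _ = prodSigmaι T.unop k ≫ prod.map t.unop (𝟙 _) ≫ f S w m := by
          rw [← Category.assoc, ← prodSigmaι_naturality, Category.assoc]
  · ext T w
    exact hf T w m k

section Boundary

/-- The nondegenerate `n`-simplex of `Δ[n]`. -/
def fundamentalSimplex (n : ℕ) : (Δ[n] : SSet.{0}).obj (op ⦋n⦌) :=
  SSet.stdSimplex.objEquiv.symm (𝟙 ⦋n⦌)

variable {n : ℕ}

/-- The simplex of `∂Δ[n]` given by a map that is not surjective. -/
def boundarySimplex {m : SimplexCategory} (α : m ⟶ ⦋n⦌) (hα : ¬ Function.Surjective α.toOrderHom) :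
    (SSet.boundary.{0} n : SSet).obj (op m) :=
  ⟨SSet.stdSimplex.objEquiv.symm α, hα⟩

lemma map_fundamentalSimplex {m : SimplexCategoryᵒᵖ} (k : (Δ[n] : SSet.{0}).obj m) :
    (Δ[n] : SSet.{0}).map (SSet.stdSimplex.objEquiv k).op (fundamentalSimplex n) = k := by
  rw [SSet.stdSimplex.map_apply, fundamentalSimplex]
  simp

lemma comp_evalSimplex_stdSimplex (d : P ⟶ homPsh (discreteObj E Δ[n]) X) {m : SimplexCategoryᵒᵖ}
    (k : (Δ[n] : SSet.{0}).obj m) :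
    d ≫ evalSimplex X k =
      (d ≫ evalSimplex X (fundamentalSimplex n)) ≫
        yoneda.map (X.map (SSet.stdSimplex.objEquiv k).op) := by
  rw [Category.assoc, ← evalSimplex_map, map_fundamentalSimplex]

lemma exists_comp_evalSimplex_stdSimplex_eq (x : P ⟶ yoneda.obj (X.obj (op ⦋n⦌))) :
    ∃ d : P ⟶ homPsh (discreteObj E Δ[n]) X,
      ∀ (m : SimplexCategoryᵒᵖ) (k : (Δ[n] : SSet.{0}).obj m),
        d ≫ evalSimplex X k = x ≫ yoneda.map (X.map (SSet.stdSimplex.objEquiv k).op) :=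
  exists_comp_evalSimplex_eq _ fun m m' α k ↦ by
    rw [SSet.stdSimplex.map_apply, Equiv.apply_symm_apply, op_comp, X.map_comp, yoneda.map_comp,
      Category.assoc, Quiver.Hom.op_unop]

lemma hasBoundaryFillers_of_hasEnrichedLiftingProperty {p : X ⟶ Y}
    (h : HasEnrichedLiftingProperty (discreteMap E (SSet.boundary.{0} n).ι) p)
    (P : Eᵒᵖ ⥤ Type v) : HasBoundaryFillers P (Functor.whiskerRight p yoneda) n := by
  intro bd base bd_isOver
  obtain ⟨f, hf⟩ := exists_comp_evalSimplex_eq (K := (SSet.boundary.{0} n : SSet))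
    (fun m k ↦ bd.app (SSet.stdSimplex.objEquiv k.1) k.2) fun m m' α k ↦ bd.app_comp α.unop _ _ _
  obtain ⟨g, hg⟩ := exists_comp_evalSimplex_stdSimplex_eq base
  obtain ⟨d, hdf, hdg⟩ := (hasEnrichedLiftingProperty_iff_forall_exists _ _).1 h f g
    (evalSimplex_hom_ext fun m k ↦ by
      rw [Category.assoc, Category.assoc, homPshPostcomp_evalSimplex, homPshPrecomp_evalSimplex,
        reassoc_of% hf, hg]
      exact bd_isOver _ _)
  refine ⟨d ≫ evalSimplex X (fundamentalSimplex n), ?_, fun m α hα ↦ ?_⟩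
  · calc (d ≫ evalSimplex X (fundamentalSimplex n)) ≫ yoneda.map (p.app (op ⦋n⦌))
        = g ≫ evalSimplex Y (fundamentalSimplex n) := by
          rw [Category.assoc, ← homPshPostcomp_evalSimplex, reassoc_of% hdg]
      _ = base := by
          rw [hg, fundamentalSimplex, Equiv.apply_symm_apply, op_id, Y.map_id]
          simp
  · calc (d ≫ evalSimplex X (fundamentalSimplex n)) ≫ yoneda.map (X.map α.op)
        = d ≫ evalSimplex X ((SSet.boundary.{0} n).ι.app _ (boundarySimplex α hα)) :=
          (comp_evalSimplex_stdSimplex d _).symm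
      _ = f ≫ evalSimplex X (boundarySimplex α hα) := by
          rw [← homPshPrecomp_evalSimplex, reassoc_of% hdf]
      _ = bd.app α hα := hf _ _

lemma hasEnrichedLiftingProperty_of_hasBoundaryFillers {p : X ⟶ Y}
    (h : ∀ P : Eᵒᵖ ⥤ Type v, HasBoundaryFillers P (Functor.whiskerRight p yoneda) n) :
    HasEnrichedLiftingProperty (discreteMap E (SSet.boundary.{0} n).ι) p := by
  refine (hasEnrichedLiftingProperty_iff_forall_exists _ _).2 fun P f g hfg ↦ ?_
  have bd_base {m : SimplexCategoryᵒᵖ} (k : (SSet.boundary.{0} n : SSet).obj m) :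
      (f ≫ evalSimplex X k) ≫ yoneda.map (p.app m) = g ≫ evalSimplex Y k.1 := by
    rw [Category.assoc, ← homPshPostcomp_evalSimplex, reassoc_of% hfg, homPshPrecomp_evalSimplex]
    rfl
  let bd : BoundaryMap P (X ⋙ yoneda) n :=
    { app m α hα := f ≫ evalSimplex X (boundarySimplex α hα)
      app_comp m m' γ α hα hγα := by
        rw [Category.assoc]
        exact congr(f ≫ $(evalSimplex_map γ.op (boundarySimplex α hα))) }
  obtain ⟨x, hx_base, hx_bd⟩ := h P bd (g ≫ evalSimplex Y (fundamentalSimplex n))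
    fun m α hα ↦ (bd_base _).trans (comp_evalSimplex_stdSimplex g _)
  obtain ⟨d, hd⟩ := exists_comp_evalSimplex_stdSimplex_eq x
  refine ⟨d, evalSimplex_hom_ext fun m k ↦ ?_, evalSimplex_hom_ext fun m k ↦ ?_⟩
  · rw [Category.assoc, homPshPrecomp_evalSimplex, hd]
    exact hx_bd (SSet.stdSimplex.objEquiv k.1) k.2
  · rw [Category.assoc, homPshPostcomp_evalSimplex, reassoc_of% hd, ← yoneda.map_comp,
      p.naturality, yoneda.map_comp, comp_evalSimplex_stdSimplex g, ← hx_base]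
    rfl

lemma isEnrichedFibration_boundaryInclusions_iff {p : X ⟶ Y} :
    IsEnrichedFibration (boundaryInclusions E) p ↔ ∀ (n : ℕ) (P : Eᵒᵖ ⥤ Type v),
      HasBoundaryFillers P (Functor.whiskerRight p yoneda) n := by
  refine ⟨fun h n ↦ hasBoundaryFillers_of_hasEnrichedLiftingProperty (h _ (.mk n)),
    fun h A B i hi ↦ ?_⟩
  obtain ⟨n⟩ := hi
  exact hasEnrichedLiftingProperty_of_hasBoundaryFillers (h n)

end Boundary

end Discrete

section Sufficiency

variable {E : Type u} [Category.{v} E] [CountablyLextensive E] {A B : SimplicialObject E}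
  {i : A ⟶ B}

lemma isCofibration_of_isRelativelyComplementedAt (hi : IsLevelwiseComplementedInclusion i)
    (hs : ∀ ⦃m n : SimplexCategory⦄ (s : m ⟶ n), Function.Surjective s.toOrderHom →
      IsRelativelyComplementedAt i s) : IsCofibration i := fun _ _ p hp ↦
  (hasEnrichedLiftingProperty_iff i p).2 fun P ↦
    hasLiftingProperty_of_isRelativelyComplementedAt hi hs (fun _ ↦ isExtensiveSheaf_yoneda P _)
      (fun _ ↦ isExtensiveSheaf_yoneda P _)
      fun n ↦ isEnrichedFibration_boundaryInclusions_iff.1 hp n _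

end Sufficiency

section Underlying

variable {E : Type u} [Category.{v} E] [HasFiniteLimits E] {A B X Y : SimplicialObject E}
  {i : A ⟶ B} {p : X ⟶ Y}

lemma HasEnrichedLiftingProperty.hasLiftingProperty (h : HasEnrichedLiftingProperty i p) :
    HasLiftingProperty i p := by
  let P : Eᵒᵖ ⥤ Type v := (Functor.const _).obj PUnit
  let extend {A X : SimplicialObject E} (f : A ⟶ X) : A ⋙ prodYoneda P ⟶ X ⋙ yoneda :=
    { app n := prodYonedaHomMk (fun _ _ a ↦ a ≫ f.app n) fun _ _ _ _ _ ↦ Category.assoc _ _ _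
      naturality n n' α := prodYoneda_hom_ext fun Z _ a ↦
        (by simp : (a ≫ A.map α) ≫ f.app n' = (a ≫ f.app n) ≫ X.map α) }
  refine ⟨fun {f g} sq ↦ ?_⟩
  have := (hasEnrichedLiftingProperty_iff i p).1 h P
  have sq' : CommSq (extend f) (Functor.whiskerRight i (prodYoneda P))
      (Functor.whiskerRight p yoneda) (extend g) :=
    ⟨NatTrans.ext (funext fun n ↦ prodYoneda_hom_ext fun Z _ a ↦
      (by simp [← NatTrans.comp_app, sq.w] : (a ≫ f.app n) ≫ p.app n = (a ≫ i.app n) ≫ g.app n))⟩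
  let lift (n : SimplexCategoryᵒᵖ) : B.obj n ⟶ X.obj n :=
    prodYonedaApp (sq'.lift.app n) PUnit.unit (𝟙 _)
  have comp_lift {n : SimplexCategoryᵒᵖ} {Z : E} (b : Z ⟶ B.obj n) :
      b ≫ lift n = prodYonedaApp (sq'.lift.app n) PUnit.unit b :=
    (prodYonedaApp_map _ _ _ _).symm.trans (by rw [Category.comp_id]; rfl)
  refine ⟨⟨⟨{ app := lift, naturality n n' α := ?_ }, ?_, ?_⟩⟩⟩
  · rw [comp_lift, ← prodYonedaApp_app, Category.id_comp]
  · ext n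
    have h_fac := congr(prodYonedaApp (($sq'.fac_left).app n) PUnit.unit (𝟙 _))
    rw [← Category.id_comp (f.app n), NatTrans.comp_app, comp_lift, ← Category.id_comp (i.app n)]
    exact h_fac
  · ext n
    have h_fac := congr(prodYonedaApp (($sq'.fac_right).app n) PUnit.unit (𝟙 _))
    exact h_fac.trans (Category.id_comp _)

end Underlying

section Cofree

instance (a b : SimplexCategoryᵒᵖ) : Finite (a ⟶ b) :=
  Finite.of_equiv _ (opEquiv a b).symm

variable {E : Type u} [Category.{v} E] [HasFiniteProducts E] {M M' : E} {X : SimplicialObject E}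
  {k m n : SimplexCategory}

variable (m) in
/-- The functor sending `M` to the simplicial object cofreely generated by `M` in degree `m`: in
degree `k` it is the product of copies of `M` indexed by the maps `m ⟶ k`. -/
abbrev cofree : E ⥤ SimplicialObject E :=
  evaluationRightAdjoint E (op m)

/-- The projection of a cofree simplicial object onto the factor indexed by `y`. -/
def cofreeProj (M : E) (y : m ⟶ k) : ((cofree m).obj M).obj (op k) ⟶ M :=
  Pi.π (fun _ : op k ⟶ op m ↦ M) y.op

/-- Maps into a cofree simplicial object are determined by their component in the generating
degree. -/
def cofreeEquiv : (X.obj (op m) ⟶ M) ≃ (X ⟶ (cofree m).obj M) :=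
  (evaluationAdjunctionLeft E (op m)).homEquiv X M

lemma cofree_map_comp_proj {k' : SimplexCategory} (α : k ⟶ k') (y : m ⟶ k) :
    ((cofree m).obj M).map α.op ≫ cofreeProj M y = cofreeProj M (y ≫ α) :=
  Pi.lift_π _ _

lemma cofreeMap_app_comp_proj (b : M ⟶ M') (y : m ⟶ k) :
    ((cofree m).map b).app (op k) ≫ cofreeProj M' y = cofreeProj M y ≫ b :=
  Pi.lift_π _ _

lemma cofreeEquiv_app_comp_proj (f : X.obj (op m) ⟶ M) (y : m ⟶ k) :
    (cofreeEquiv f).app (op k) ≫ cofreeProj M y = X.map y.op ≫ f := by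
  rw [cofreeEquiv, evaluationAdjunctionLeft, Adjunction.mkOfHomEquiv_homEquiv]
  exact Pi.lift_π _ _

lemma cofreeEquiv_comp_map (f : X.obj (op m) ⟶ M) (b : M ⟶ M') :
    cofreeEquiv f ≫ (cofree m).map b = cofreeEquiv (f ≫ b) :=
  ((evaluationAdjunctionLeft E (op m)).homEquiv_naturality_right f b).symm

lemma comp_cofreeEquiv {W : SimplicialObject E} (i : W ⟶ X) (f : X.obj (op m) ⟶ M) :
    i ≫ cofreeEquiv f = cofreeEquiv (i.app (op m) ≫ f) :=
  ((evaluationAdjunctionLeft E (op m)).homEquiv_naturality_left i f).symm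

variable {P : Eᵒᵖ ⥤ Type v}

lemma cofree_yoneda_hom_ext {f g : P ⟶ yoneda.obj (((cofree m).obj M).obj (op k))}
    (h : ∀ y : m ⟶ k, f ≫ yoneda.map (cofreeProj M y) = g ≫ yoneda.map (cofreeProj M y)) :
    f = g := by
  ext Z w
  refine Pi.hom_ext _ _ fun y ↦ ?_
  exact ConcreteCategory.congr_hom (NatTrans.congr_app (h y.unop) Z) w

lemma exists_comp_cofreeProj_eq (F : (m ⟶ k) → (P ⟶ yoneda.obj M)) :
    ∃ f : P ⟶ yoneda.obj (((cofree m).obj M).obj (op k)),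
      ∀ y, f ≫ yoneda.map (cofreeProj M y) = F y := by
  refine ⟨{ app Z := ↾fun w ↦ Pi.lift fun y : op k ⟶ op m ↦ (F y.unop).app Z w,
            naturality Z Z' t := ?_ }, fun y ↦ ?_⟩
  · ext w
    refine Pi.hom_ext _ _ fun y ↦ (Pi.lift_π _ _).trans ?_
    refine (ConcreteCategory.congr_hom ((F y.unop).naturality t) w).trans ?_
    exact (congr(t.unop ≫ $(Pi.lift_π (fun y : op k ⟶ op m ↦ (F y.unop).app Z w) y)).symm).trans
      (Category.assoc _ _ _).symm
  · ext Z w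
    exact Pi.lift_π _ _

lemma BoundaryMap.exists_cofree_filler {l : ℕ} (bd : BoundaryMap P ((cofree m).obj M ⋙ yoneda) l)
    (F : (m ⟶ ⦋l⦌) → (P ⟶ yoneda.obj M))
    (hF : ∀ (y : m ⟶ ⦋l⦌) (hy : ¬ Function.Surjective y.toOrderHom),
      F y = bd.app y hy ≫ yoneda.map (cofreeProj M (𝟙 m))) :
    ∃ f : P ⟶ yoneda.obj (((cofree m).obj M).obj (op ⦋l⦌)),
      (∀ y, f ≫ yoneda.map (cofreeProj M y) = F y) ∧ bd.IsFilledBy f := by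
  obtain ⟨f, hf⟩ := exists_comp_cofreeProj_eq F
  refine ⟨f, hf, fun k α hα ↦ cofree_yoneda_hom_ext fun y ↦ ?_⟩
  have hyα : ¬ Function.Surjective (y ≫ α).toOrderHom := fun h ↦ hα (.of_comp h)
  rw [Functor.comp_map, Category.assoc, ← yoneda.map_comp, cofree_map_comp_proj, hf, hF _ hyα,
    bd.app_comp y α hα, Functor.comp_map, Category.assoc, ← yoneda.map_comp,
    cofree_map_comp_proj, Category.id_comp]

lemma comp_cofreeProj_id_comp {b : M ⟶ M'} {y : m ⟶ k}
    {x : P ⟶ yoneda.obj (((cofree m).obj M).obj (op m))}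
    {base : P ⟶ yoneda.obj (((cofree m).obj M').obj (op k))}
    (h : x ≫ yoneda.map (((cofree m).map b).app (op m)) =
      base ≫ yoneda.map (((cofree m).obj M').map y.op)) :
    (x ≫ yoneda.map (cofreeProj M (𝟙 m))) ≫ yoneda.map b =
      base ≫ yoneda.map (cofreeProj M' y) := by
  rw [Category.assoc, ← yoneda.map_comp, ← cofreeMap_app_comp_proj, yoneda.map_comp,
    reassoc_of% h, ← yoneda.map_comp, cofree_map_comp_proj, Category.id_comp]

lemma hasBoundaryFillers_cofreeMap {b : M ⟶ M'} (b' : M' ⟶ M) (hb : b' ≫ b = 𝟙 M') (l : ℕ) :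
    HasBoundaryFillers P (Functor.whiskerRight ((cofree m).map b) yoneda) l := by
  intro bd base bd_isOver
  have exists_value (y : m ⟶ ⦋l⦌) : ∃ v : P ⟶ yoneda.obj M,
      (∀ hy, v = bd.app y hy ≫ yoneda.map (cofreeProj M (𝟙 m))) ∧
      v ≫ yoneda.map b = base ≫ yoneda.map (cofreeProj M' y) := by
    by_cases hy : Function.Surjective y.toOrderHom
    · exact ⟨base ≫ yoneda.map (cofreeProj M' y ≫ b'), fun hy' ↦ absurd hy hy', by
        rw [Category.assoc, ← yoneda.map_comp, Category.assoc, hb, Category.comp_id]⟩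
    · exact ⟨bd.app y hy ≫ yoneda.map (cofreeProj M (𝟙 m)), fun _ ↦ rfl,
        comp_cofreeProj_id_comp (bd_isOver y hy)⟩
  choose F hF_bd hF_base using exists_value
  obtain ⟨f, hf, hf_bd⟩ := bd.exists_cofree_filler F hF_bd
  refine ⟨f, cofree_yoneda_hom_ext fun y ↦ ?_, hf_bd⟩
  rw [Functor.whiskerRight_app, Category.assoc, ← yoneda.map_comp, cofreeMap_app_comp_proj,
    yoneda.map_comp, reassoc_of% hf y, hF_base]

/-- The restriction of cofree simplicial objects along `s : m ⟶ n`: its component at `x : n ⟶ k` is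
the component at `s ≫ x`. -/
def cofreeRestrict (s : m ⟶ n) (M : E) : (cofree m).obj M ⟶ (cofree n).obj M :=
  cofreeEquiv (cofreeProj M s)

lemma cofreeRestrict_app_comp_proj (s : m ⟶ n) (x : n ⟶ k) :
    (cofreeRestrict s M).app (op k) ≫ cofreeProj M x = cofreeProj M (s ≫ x) := by
  rw [cofreeRestrict, cofreeEquiv_app_comp_proj, cofree_map_comp_proj]

lemma cofreeEquiv_comp_cofreeRestrict (f : X.obj (op m) ⟶ M) (s : m ⟶ n) :
    cofreeEquiv f ≫ cofreeRestrict s M = cofreeEquiv (X.map s.op ≫ f) := by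
  rw [cofreeRestrict, comp_cofreeEquiv, cofreeEquiv_app_comp_proj]

lemma cofreeRestrict_naturality (s : m ⟶ n) (b : M ⟶ M') :
    cofreeRestrict s M ≫ (cofree n).map b = (cofree m).map b ≫ cofreeRestrict s M' := by
  rw [cofreeRestrict, cofreeRestrict, cofreeEquiv_comp_map, comp_cofreeEquiv,
    cofreeMap_app_comp_proj]

lemma comp_cofreeProj_id_eq {s : m ⟶ n} {x : n ⟶ k}
    {u : P ⟶ yoneda.obj (((cofree m).obj M).obj (op n))}
    {base : P ⟶ yoneda.obj (((cofree n).obj M).obj (op k))}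
    (h : u ≫ yoneda.map ((cofreeRestrict s M).app (op n)) =
      base ≫ yoneda.map (((cofree n).obj M).map x.op)) :
    (u ≫ yoneda.map (((cofree m).obj M).map s.op)) ≫ yoneda.map (cofreeProj M (𝟙 m)) =
      base ≫ yoneda.map (cofreeProj M x) := by
  have := h =≫ yoneda.map (cofreeProj M (𝟙 n))
  simpa only [Category.assoc, ← yoneda.map_comp, cofree_map_comp_proj,
    cofreeRestrict_app_comp_proj, Category.id_comp, Category.comp_id] using this

lemma BoundaryMap.exists_cofreeRestrict_filler {s : m ⟶ n} [Epi s] {b : M ⟶ M'} (b' : M' ⟶ M)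
    (hb : b' ≫ b = 𝟙 M') {l : ℕ} (bd : BoundaryMap P ((cofree m).obj M ⋙ yoneda) l)
    {base₁ : P ⟶ yoneda.obj (((cofree n).obj M).obj (op ⦋l⦌))}
    {base₂ : P ⟶ yoneda.obj (((cofree m).obj M').obj (op ⦋l⦌))}
    (h_base : base₁ ≫ yoneda.map (((cofree n).map b).app _) =
      base₂ ≫ yoneda.map ((cofreeRestrict s M').app _))
    (bd_base₁ : bd.IsOver (Functor.whiskerRight (cofreeRestrict s M) yoneda) base₁)
    (bd_base₂ : bd.IsOver (Functor.whiskerRight ((cofree m).map b) yoneda) base₂) :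
    ∃ f : P ⟶ yoneda.obj (((cofree m).obj M).obj (op ⦋l⦌)),
      f ≫ yoneda.map ((cofreeRestrict s M).app _) = base₁ ∧
      f ≫ yoneda.map (((cofree m).map b).app _) = base₂ ∧ bd.IsFilledBy f := by
  have exists_value (y : m ⟶ ⦋l⦌) : ∃ v : P ⟶ yoneda.obj M,
      (∀ hy, v = bd.app y hy ≫ yoneda.map (cofreeProj M (𝟙 m))) ∧
      (∀ x, s ≫ x = y → v = base₁ ≫ yoneda.map (cofreeProj M x)) ∧
      v ≫ yoneda.map b = base₂ ≫ yoneda.map (cofreeProj M' y) := by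
    by_cases hy : Function.Surjective y.toOrderHom
    · by_cases hsy : ∃ x, s ≫ x = y
      · obtain ⟨x, rfl⟩ := hsy
        refine ⟨base₁ ≫ yoneda.map (cofreeProj M x), fun hy' ↦ absurd hy hy', fun x' hx' ↦ ?_, ?_⟩
        · rw [(cancel_epi s).1 hx']
        · rw [Category.assoc, ← yoneda.map_comp, ← cofreeMap_app_comp_proj, yoneda.map_comp,
            reassoc_of% h_base, ← yoneda.map_comp, cofreeRestrict_app_comp_proj]
      · exact ⟨base₂ ≫ yoneda.map (cofreeProj M' y ≫ b'), fun hy' ↦ absurd hy hy',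
          fun x hx ↦ absurd ⟨x, hx⟩ hsy, by
            rw [Category.assoc, ← yoneda.map_comp, Category.assoc, hb, Category.comp_id]⟩
    · refine ⟨bd.app y hy ≫ yoneda.map (cofreeProj M (𝟙 m)), fun _ ↦ rfl, ?_,
        comp_cofreeProj_id_comp (bd_base₂ y hy)⟩
      rintro x rfl
      have hx : ¬ Function.Surjective x.toOrderHom := fun hx ↦ hy
        (hx.comp (SimplexCategory.epi_iff_surjective.1 ‹Epi s›))
      rw [bd.app_comp s x hx hy]
      exact comp_cofreeProj_id_eq (bd_base₁ x hx)
  choose F hF_bd hF_restrict hF_base using exists_value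
  obtain ⟨f, hf, hf_bd⟩ := bd.exists_cofree_filler F hF_bd
  refine ⟨f, cofree_yoneda_hom_ext fun x ↦ ?_, cofree_yoneda_hom_ext fun y ↦ ?_, hf_bd⟩
  · rw [Category.assoc, ← yoneda.map_comp, cofreeRestrict_app_comp_proj, hf, hF_restrict _ _ rfl]
  · rw [Category.assoc, ← yoneda.map_comp, cofreeMap_app_comp_proj, yoneda.map_comp,
      reassoc_of% hf y, hF_base]

lemma hasBoundaryFillers_of_isPullback [HasPullbacks E] {s : m ⟶ n} [Epi s] {b : M ⟶ M'}
    (b' : M' ⟶ M) (hb : b' ≫ b = 𝟙 M') {Z : SimplicialObject E} {fst : Z ⟶ (cofree n).obj M}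
    {snd : Z ⟶ (cofree m).obj M'}
    (sq : IsPullback fst snd ((cofree n).map b) (cofreeRestrict s M'))
    {p : (cofree m).obj M ⟶ Z} (hp₁ : p ≫ fst = cofreeRestrict s M)
    (hp₂ : p ≫ snd = (cofree m).map b) (l : ℕ) :
    HasBoundaryFillers P (Functor.whiskerRight p yoneda) l := by
  intro bd base bd_isOver
  have sq_app := sq.map ((evaluation _ _).obj (op ⦋l⦌) ⋙ yoneda)
  have bd_isOver_comp {Y : SimplicialObject E} {π : Z ⟶ Y} {q : (cofree m).obj M ⟶ Y}
      (hq : p ≫ π = q) : bd.IsOver (Functor.whiskerRight q yoneda)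
        (base ≫ yoneda.map (π.app _)) := by
    intro k α hα
    rw [Functor.comp_map, Category.assoc, ← yoneda.map_comp, ← π.naturality, yoneda.map_comp, ← hq,
      Functor.whiskerRight_app, NatTrans.comp_app, yoneda.map_comp]
    exact (bd_isOver α hα =≫ yoneda.map (π.app _) :)
  obtain ⟨f, hf₁, hf₂, hf_bd⟩ := bd.exists_cofreeRestrict_filler b' hb
    (base₁ := base ≫ yoneda.map (fst.app _)) (base₂ := base ≫ yoneda.map (snd.app _))
    congr(base ≫ $sq_app.w) (bd_isOver_comp hp₁) (bd_isOver_comp hp₂)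
  refine ⟨f, sq_app.hom_ext ?_ ?_, hf_bd⟩
  · rw [← hp₁, NatTrans.comp_app, yoneda.map_comp] at hf₁
    exact hf₁
  · rw [← hp₂, NatTrans.comp_app, yoneda.map_comp] at hf₂
    exact hf₂

end Cofree

section Necessity

variable {E : Type u} [Category.{v} E] [CountablyLextensive E] {A B : SimplicialObject E}
  {i : A ⟶ B}

lemma IsCofibration.hasLiftingProperty (hi : IsCofibration i) {X Y : SimplicialObject E}
    {p : X ⟶ Y} (hp : ∀ (n : ℕ) (P : Eᵒᵖ ⥤ Type v),
      HasBoundaryFillers P (Functor.whiskerRight p yoneda) n) : HasLiftingProperty i p :=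
  (hi p (isEnrichedFibration_boundaryInclusions_iff.2 hp)).hasLiftingProperty

lemma IsCofibration.isLevelwiseComplementedInclusion (hi : IsCofibration i) :
    IsLevelwiseComplementedInclusion i := by
  intro n
  have h_lift : HasLiftingProperty i ((cofree n).map (coprod.desc (i.app (op n)) (𝟙 _))) :=
    hi.hasLiftingProperty fun l P ↦ hasBoundaryFillers_cofreeMap coprod.inr (coprod.inr_desc _ _) l
  have : HasLiftingProperty (i.app (op n)) (coprod.desc (i.app (op n)) (𝟙 _)) :=
    ((evaluationAdjunctionLeft E (op n)).hasLiftingProperty_iff i _).2 h_lift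
  have sq : CommSq coprod.inl (i.app (op n)) (coprod.desc (i.app (op n)) (𝟙 _)) (𝟙 _) :=
    ⟨by rw [coprod.inl_desc, Category.comp_id]⟩
  exact isComplementedInclusion_of_lift _ sq.lift sq.fac_left sq.fac_right

/-- The transpose of the lifting property of a cofibration against the map from
`(cofree m).obj M` to the pullback of `(cofree n).obj M` and `(cofree m).obj M'` over
`(cofree n).obj M'`. -/
lemma IsCofibration.exists_lift (hi : IsCofibration i) {m n : SimplexCategory} (s : m ⟶ n)
    [Epi s] {M M' : E} {b : M ⟶ M'} (b' : M' ⟶ M) (hb : b' ≫ b = 𝟙 M')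
    (h : A.obj (op m) ⟶ M) (g' : B.obj (op n) ⟶ M) (h' : B.obj (op m) ⟶ M')
    (hgh : A.map s.op ≫ h = i.app _ ≫ g') (hgh' : g' ≫ b = B.map s.op ≫ h')
    (hh : h ≫ b = i.app _ ≫ h') :
    ∃ e : B.obj (op m) ⟶ M, i.app _ ≫ e = h ∧ e ≫ b = h' ∧ B.map s.op ≫ e = g' := by
  have pb := IsPullback.of_hasPullback ((cofree n).map b) (cofreeRestrict s M')
  let p := pb.lift (cofreeRestrict s M) ((cofree m).map b) (cofreeRestrict_naturality s b)
  have hp₁ : p ≫ pullback.fst _ _ = cofreeRestrict s M := pb.lift_fst _ _ _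
  have hp₂ : p ≫ pullback.snd _ _ = (cofree m).map b := pb.lift_snd _ _ _
  have := hi.hasLiftingProperty fun l P ↦
    hasBoundaryFillers_of_isPullback (P := P) b' hb pb hp₁ hp₂ l
  have sq : CommSq (cofreeEquiv h) i p (pb.lift (cofreeEquiv g') (cofreeEquiv h')
      (by rw [cofreeEquiv_comp_map, cofreeEquiv_comp_cofreeRestrict, hgh'])) := ⟨by
    refine pb.hom_ext ?_ ?_
    · rw [Category.assoc, Category.assoc, hp₁, pb.lift_fst, comp_cofreeEquiv,
        cofreeEquiv_comp_cofreeRestrict, hgh]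
    · rw [Category.assoc, Category.assoc, hp₂, pb.lift_snd, comp_cofreeEquiv,
        cofreeEquiv_comp_map, hh]⟩
  obtain ⟨e, he⟩ := cofreeEquiv.surjective sq.lift
  have h_left : i ≫ cofreeEquiv e = cofreeEquiv h := he ▸ sq.fac_left
  have h_right : cofreeEquiv e ≫ p = pb.lift (cofreeEquiv g') (cofreeEquiv h') _ :=
    he ▸ sq.fac_right
  refine ⟨e, cofreeEquiv.injective ?_, cofreeEquiv.injective ?_, cofreeEquiv.injective ?_⟩
  · rw [← comp_cofreeEquiv, h_left]
  · rw [← cofreeEquiv_comp_map, ← hp₂, reassoc_of% h_right, pb.lift_snd]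
  · rw [← cofreeEquiv_comp_cofreeRestrict, ← hp₁, reassoc_of% h_right, pb.lift_fst]

lemma IsCofibration.isRelativelyComplementedAt (hi : IsCofibration i) {m n : SimplexCategory}
    (s : m ⟶ n) (hs : Function.Surjective s.toOrderHom) : IsRelativelyComplementedAt i s := by
  have hpush := (hi.isLevelwiseComplementedInclusion n).hasPushout (A.map s.op)
  have := SimplexCategory.epi_iff_surjective.2 hs
  refine ⟨hpush, ?_⟩
  let q : pushout (A.map s.op) (i.app (op n)) ⟶ B.obj (op m) :=
    pushout.desc (i.app (op m)) (B.map s.op) (i.naturality s.op)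
  obtain ⟨e, hie, he, hse⟩ := hi.exists_lift s (b := coprod.desc q (𝟙 _)) coprod.inr
    (coprod.inr_desc _ _) (pushout.inl _ _ ≫ coprod.inl) (pushout.inr _ _ ≫ coprod.inl) (𝟙 _)
    (pushout.condition_assoc _)
    (by rw [Category.assoc, coprod.inl_desc, pushout.inr_desc, Category.comp_id])
    (by rw [Category.assoc, coprod.inl_desc, pushout.inl_desc, Category.comp_id])
  refine isComplementedInclusion_of_lift q e (pushout.hom_ext ?_ ?_) he
  · rw [← Category.assoc, pushout.inl_desc, hie]
  · rw [← Category.assoc, pushout.inr_desc, hse]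

end Necessity

end EffectiveModel

end

/-- A map of simplicial objects in a countably lextensive category is a cofibration if and only if
it is a levelwise complemented inclusion and, for each degeneracy operator `s : [m] ⟶ [n]`
(that is, each surjective monotone map), `A_m ⊔_{A_n} B_n ⟶ B_m` is a complemented inclusion. -/
theorem mainTheorem8 {E : Type u} [Category.{v} E] [EffectiveModel.CountablyLextensive E]
    {A B : SimplicialObject E} (i : A ⟶ B) :
    EffectiveModel.IsCofibration i ↔
      EffectiveModel.IsLevelwiseComplementedInclusion i ∧
        ∀ ⦃m n : SimplexCategory⦄ (s : m ⟶ n), Function.Surjective s.toOrderHom →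
          EffectiveModel.IsRelativelyComplementedAt i s := by
  exact ⟨fun hi ↦ ⟨hi.isLevelwiseComplementedInclusion, fun _ _ s hs ↦
    hi.isRelativelyComplementedAt s hs⟩, fun h ↦
    EffectiveModel.isCofibration_of_isRelativelyComplementedAt h.1 h.2⟩
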